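/- Let $(\mathsf{Gen},\mathsf{Enc},\mathsf{Dec})$ be a public-key encryption scheme, $\mathsf E$ a randomized encoding function on message spaces $\mathcal M_n$ ($n$ the security parameter) with decoding function $\mathsf D$, and $\mathsf{SS}=(\mathsf{Gen}_{\mathsf{SS}},\mathsf{Sign},\mathsf{Ver})$ a signature scheme for arbitrary strings whose verification keys at security parameter $n$ are $k(n)$-bit strings; write $k=k(n)$. The algorithms $\mathsf{Gen},\mathsf{Enc},\mathsf E,\mathsf{Gen}_{\mathsf{SS}},\mathsf{Sign}$ are probabilistic polynomial-time, and $\mathsf{Dec},\mathsf D,\mathsf{Ver}$ are deterministic polynomial-time. (Completeness of the schemes is not needed.) The $k$-repetition $\mathsf{PKE}_k=(\mathsf{Gen}_k,\mathsf{Enc}_k,\mathsf{Dec}_k)$ generates $k$ independent key pairs $(\mathsf{pk}_i,\mathsf{sk}_i)$; it encrypts $m\in\mathcal M_n$ as $(\mathsf{Enc}(\mathsf{pk}_1,e),\dots,\mathsf{Enc}(\mathsf{pk}_k,e))$ with a single random encoding $e=\mathsf E(m;s)$ and fresh coins in every component; and $\mathsf{Dec}_k(\mathsf{sk},c)$ is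 $m$ if all $\mathsf D(\mathsf{Dec}(\mathsf{sk}_i,c_i))$ are equal to the same $m\in\mathcal M_n$, and $\perp$ otherwise. It is verifiable under uniform $k$-repetition if there is a deterministic polynomial-time algorithm $\mathsf{Verify}$ such that for all keys $(\mathsf{pk},\mathsf{sk})$ in the range of $\mathsf{Gen}_k(1^n)$, all $k$-tuples $c$ and all $i$, $\mathsf{Verify}$ accepts $(1^n,c,\mathsf{pk},i,\mathsf{sk}_i)$ if and only if $\mathsf{Dec}_k(\mathsf{sk},c)\ne\perp$. The scheme $\mathsf{PKE}_{cca2}$ has as keys $2k$ independent key pairs $(\mathsf{pk}_i^b,\mathsf{sk}_i^b)$, $1\le i\le k$, $b\in\{0,1\}$. For $\mathsf{vk}\in\{0,1\}^k$ let $\mathsf{pk}^{\mathsf{vk}}=(\mathsf{pk}_1^{\mathsf{vk}_1},\dots,\mathsf{pk}_k^{\mathsf{vk}_k})$, and likewise $\mathsf{sk}^{\mathsf{vk}}$. To encrypt $m$, generate $(\mathsf{vk},\mathsf{dsk})\leftarrow\mathsf{Gen}_{\mathsf{SS}}(1^n)$, compute $c'\leftarrow\mathsf{Enc}_k(\mathsf{pk}^{\mathsf{vk}},m)$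 and $\sigma\leftarrow\mathsf{Sign}(\mathsf{dsk},c')$, and output $(c',\mathsf{vk},\sigma)$. To decrypt $(c',\mathsf{vk},\sigma)$ with $\mathsf{vk}\in\{0,1\}^k$, output $\perp$ if $\mathsf{Ver}(\mathsf{vk},c',\sigma)=0$, and $\mathsf{Dec}_k(\mathsf{sk}^{\mathsf{vk}},c')$ otherwise; malformed ciphertexts are rejected. Theorem. If $\mathsf{SS}$ is one-time strongly unforgeable, and $\mathsf{PKE}_k$ is IND-CPA secure and verifiable under uniform $k$-repetition, then $\mathsf{PKE}_{cca2}$ is IND-CCA2 secure. Here security is the usual one against all (uniform) probabilistic polynomial-time two-stage adversaries: the probability of winning the one-time forgery experiment, respectively the distance of the probability of guessing the challenge bit from $\tfrac12$ in the IND-CPA and IND-CCA2 experiments, is a negligible function of $n$. -/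

import Mathlib

/-! ### Data

Finite binary trees over the three leaves `nil`, `0`, `1` play the role of strings.  Everything an
algorithm reads or writes is such a value; `size` is its length.  The bit string `b₁ … bₗ` is the
list value of its bits; it has size `2 * l + 1`, so two bit strings have the same length if and only
if they have the same size. -/

inductive Val : Type
  | nil : Val
  | bit : Bool → Val
  | pair : Val → Val → Val
  deriving DecidableEq

namespace Val

/-- Number of nodes. -/
def size : Val → ℕ
  | nil => 1
  | bit _ => 1
  | pair a b => a.size + b.size + 1

def fst : Val → Val
  | pair a _ => a
  | _ => nil

def snd : Val → Val
  | pair _ b => b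
  | _ => nil

def ofList : List Val → Val
  | [] => nil
  | a :: l => pair a (ofList l)

/-- The entries along the right spine; `toList (ofList l) = l`. -/
def toList : Val → List Val
  | pair a b => a :: b.toList
  | _ => []

def ofBits (l : List Bool) : Val := ofList (l.map bit)

/-- `toBits (ofBits l) = l`. -/
def toBits (v : Val) : List Bool := v.toList.map fun a => decide (a = bit true)

/-- The string `1ⁿ`. -/
def unary (n : ℕ) : Val := ofBits (List.replicate n true)

/-- An error symbol or a value: `none` stands for the error symbol. -/
def ofOption : Option Val → Val
  | none => nil
  | some m => pair nil m

end Val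

/-! ### Probabilistic oracle programs with a cost

A program maps a value to a value.  Executing a construct on input `x` costs `1 + size x` (for a
constant `v`, `1 + size x + size v`) plus the cost of its parts, so that the cost bounds from above
the size of every value produced.  `fold` is the only loop.  Loops are bounded, hence all programs
halt; the programs of polynomial cost compute exactly the polynomial-time functions, because a
polynomial clock for a machine can be built by nested folds, and the machine be stepped by a fold
over that clock. -/

inductive Prog : Type
  /-- the identity -/
  | id : Prog
  /-- a constant -/
  | const : Val → Prog
  /-- `comp p q` runs `q` on the input and then `p` on the result -/
  | comp : Prog → Prog → Prog
  /-- runs both programs on the input and pairs the results -/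
  | pair : Prog → Prog → Prog
  /-- first component -/
  | fst : Prog
  /-- second component -/
  | snd : Prog
  /-- equality test of the two components of the input -/
  | eq : Prog
  /-- tests whether the first component is at most as long as the second -/
  | sizeLe : Prog
  /-- `ite c p q` runs `p` on the input if `c` returns the bit 1 on it, and `q` otherwise -/
  | ite : Prog → Prog → Prog → Prog
  /-- on input `(acc, (x₁, …, xₘ))`, updates `acc` to `p (acc, xⱼ)` for `j = 1, …, m` -/
  | fold : Prog → Prog
  /-- a fair random bit -/
  | coin : Prog
  /-- on input `(q, b)`, asks the oracle for its answer to `q`.  The value `b` is the space made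
  available for the answer: an answer longer than `b` is not delivered. -/
  | query : Prog

noncomputable section

/-- A fair coin. -/
def fairCoin : PMF Bool := PMF.uniformOfFintype Bool

/-- Successive independent sampling. -/
def sampleList {α : Type} : List (PMF α) → PMF (List α)
  | [] => PMF.pure []
  | p :: l => p.bind fun a => (sampleList l).bind fun as => PMF.pure (a :: as)

namespace Prog

/-- The loop of `fold`, with the sum of the costs of the iterations. -/
def foldRun (step : Val → PMF (Val × ℕ)) : List Val → Val → PMF (Val × ℕ)
  | [], acc => PMF.pure (acc, 0)
  | a :: l, acc =>
      (step (Val.pair acc a)).bind fun r =>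
        (foldRun step l r.1).bind fun s => PMF.pure (s.1, r.2 + s.2)

/-- The joint distribution of the output and the cost of a program with oracle `O` on an input. -/
def run (O : Val → Val) : Prog → Val → PMF (Val × ℕ)
  | id, x => PMF.pure (x, 1 + x.size)
  | const v, x => PMF.pure (v, 1 + x.size + v.size)
  | comp p q, x =>
      (run O q x).bind fun r => (run O p r.1).bind fun s =>
        PMF.pure (s.1, 1 + x.size + r.2 + s.2)
  | pair p q, x =>
      (run O p x).bind fun r => (run O q x).bind fun s =>
        PMF.pure (Val.pair r.1 s.1, 1 + x.size + r.2 + s.2)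
  | fst, x => PMF.pure (x.fst, 1 + x.size)
  | snd, x => PMF.pure (x.snd, 1 + x.size)
  | eq, x => PMF.pure (Val.bit (decide (x.fst = x.snd)), 1 + x.size)
  | sizeLe, x => PMF.pure (Val.bit (decide (x.fst.size ≤ x.snd.size)), 1 + x.size)
  | ite c p q, x =>
      (run O c x).bind fun r =>
        (if r.1 = Val.bit true then run O p x else run O q x).bind fun s =>
          PMF.pure (s.1, 1 + x.size + r.2 + s.2)
  | fold p, x =>
      (foldRun (fun y => run O p y) x.snd.toList x.fst).bind fun s =>
        PMF.pure (s.1, 1 + x.size + s.2)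
  | coin, x => fairCoin.bind fun b => PMF.pure (Val.bit b, 1 + x.size)
  | query, x =>
      PMF.pure (if (O x.fst).size ≤ x.snd.size then O x.fst else Val.nil, 1 + x.size)

/-- The output distribution with oracle `O`. -/
def outO (p : Prog) (O : Val → Val) (x : Val) : PMF Val := (p.run O x).map Prod.fst

/-- The output distribution without an oracle (every query is answered by `nil`). -/
def out (p : Prog) (x : Val) : PMF Val := p.outO (fun _ => Val.nil) x

/-- Strict polynomial time: for every oracle, every input and all coins, the cost is at most a
fixed polynomial of the length of the input. -/
def PolyTime (p : Prog) : Prop :=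
  ∃ P : Polynomial ℕ, ∀ (O : Val → Val) (x : Val), ∀ r ∈ (p.run O x).support,
    r.2 ≤ P.eval x.size

end Prog

/-- The randomized function `f`, on arguments written as values by `code`, is computed by a
probabilistic polynomial-time algorithm. -/
def IsPPT {α : Type} (code : α → Val) (f : α → PMF Val) : Prop :=
  ∃ p : Prog, p.PolyTime ∧ ∀ a, p.out (code a) = f a

/-- The function `f` is computed in polynomial time.  (An algorithm whose output is always `f a`
may be run with all its coins replaced by 0.) -/
def IsPolyTime {α : Type} (code : α → Val) (f : α → Val) : Prop :=
  IsPPT code fun a => PMF.pure (f a)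

/-- Negligible functions. -/
def Negligible (f : ℕ → ℝ) : Prop :=
  Asymptotics.SuperpolynomialDecay Filter.atTop (fun n : ℕ => (n : ℝ)) f

/-! ### Public-key encryption -/

/-- The algorithms of a public-key encryption scheme; the first argument is the security
parameter. -/
structure PKE where
  /-- the message space -/
  msg : ℕ → Set Val
  /-- generates a public key and a secret key -/
  gen : ℕ → PMF (Val × Val)
  /-- encrypts a message under a public key -/
  enc : ℕ → Val → Val → PMF Val
  /-- decrypts a ciphertext with a secret key; `none` is the error symbol -/
  dec : ℕ → Val → Val → Option Val

namespace PKE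

/-- Key generation and encryption are probabilistic polynomial-time, decryption is deterministic
polynomial-time. -/
structure Efficient (S : PKE) : Prop where
  gen : IsPPT Val.unary fun n => (S.gen n).map fun r => Val.pair r.1 r.2
  enc : IsPPT (fun a : ℕ × Val × Val => Val.pair (Val.unary a.1) (Val.pair a.2.1 a.2.2))
    fun a => S.enc a.1 a.2.1 a.2.2
  dec : IsPolyTime (fun a : ℕ × Val × Val => Val.pair (Val.unary a.1) (Val.pair a.2.1 a.2.2))
    fun a => Val.ofOption (S.dec a.1 a.2.1 a.2.2)

open Classical in
/-- The IND-CCA2 experiment, with the answers `O₁ n sk` and `O₂ n sk c` of the oracles left open (`c`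
is the challenge ciphertext).  The output of the first stage is read as `(m⁰, (m¹, state))`; the
final guess is 1 if the second stage returns the bit 1, and 0 otherwise.  If the two
messages are not two messages of the same length, the result is a fair coin, so that nothing is
gained by it. -/
def experiment (S : PKE) (O₁ : ℕ → Val → Val → Val) (O₂ : ℕ → Val → Val → Val → Val)
    (A₁ A₂ : Prog) (n : ℕ) : PMF Bool :=
  (S.gen n).bind fun key =>
  (A₁.outO (O₁ n key.2) (Val.pair (Val.unary n) key.1)).bind fun r =>
  let m₀ := r.fst
  let m₁ := r.snd.fst
  let state := r.snd.snd
  if m₀ ∈ S.msg n ∧ m₁ ∈ S.msg n ∧ m₀.size = m₁.size then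
    fairCoin.bind fun b =>
    (S.enc n key.1 (if b then m₁ else m₀)).bind fun c =>
    (A₂.outO (O₂ n key.2 c) (Val.pair c state)).bind fun g =>
    PMF.pure (decide (g = Val.bit true) == b)
  else fairCoin

/-- The IND-CPA experiment: no oracle. -/
def cpaExperiment (S : PKE) (A₁ A₂ : Prog) (n : ℕ) : PMF Bool :=
  S.experiment (fun _ _ _ => Val.nil) (fun _ _ _ _ => Val.nil) A₁ A₂ n

/-- The IND-CCA2 experiment: both stages have the decryption oracle, the second one may not ask for
the decryption of the challenge ciphertext. -/
def cca2Experiment (S : PKE) (A₁ A₂ : Prog) (n : ℕ) : PMF Bool :=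
  S.experiment (fun n sk q => Val.ofOption (S.dec n sk q))
    (fun n sk c q => if q = c then Val.nil else Val.ofOption (S.dec n sk q)) A₁ A₂ n

def INDCPA (S : PKE) : Prop :=
  ∀ A₁ A₂ : Prog, A₁.PolyTime → A₂.PolyTime →
    Negligible fun n => |(S.cpaExperiment A₁ A₂ n true).toReal - 1 / 2|

def INDCCA2 (S : PKE) : Prop :=
  ∀ A₁ A₂ : Prog, A₁.PolyTime → A₂.PolyTime →
    Negligible fun n => |(S.cca2Experiment A₁ A₂ n true).toReal - 1 / 2|

end PKE

/-! ### Signatures -/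

/-- The algorithms of a signature scheme for arbitrary strings, whose verification keys are bit
strings. -/
structure SignatureScheme where
  /-- generates a verification key and a signing key -/
  gen : ℕ → PMF (List Bool × Val)
  /-- signs a message with a signing key -/
  sign : ℕ → Val → Val → PMF Val
  /-- checks, with a verification key, a message and a signature -/
  ver : ℕ → List Bool → Val → Val → Bool

namespace SignatureScheme

structure Efficient (SS : SignatureScheme) : Prop where
  gen : IsPPT Val.unary fun n => (SS.gen n).map fun r => Val.pair (Val.ofBits r.1) r.2
  sign : IsPPT (fun a : ℕ × Val × Val => Val.pair (Val.unary a.1) (Val.pair a.2.1 a.2.2))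
    fun a => SS.sign a.1 a.2.1 a.2.2
  ver : IsPolyTime
    (fun a : ℕ × List Bool × Val × Val => Val.pair (Val.unary a.1)
      (Val.pair (Val.ofBits a.2.1) (Val.pair a.2.2.1 a.2.2.2)))
    fun a => Val.bit (SS.ver a.1 a.2.1 a.2.2.1 a.2.2.2)

/-- The experiment of one-time strong unforgeability.  The first stage returns `(m, state)`, the
second one, on `(m, (σ, state))`, a forgery `(m*, σ*)`. -/
def otsuExperiment (SS : SignatureScheme) (A₁ A₂ : Prog) (n : ℕ) : PMF Bool :=
  (SS.gen n).bind fun key =>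
  (A₁.out (Val.pair (Val.unary n) (Val.ofBits key.1))).bind fun r =>
  (SS.sign n key.2 r.fst).bind fun sig =>
  (A₂.out (Val.pair r.fst (Val.pair sig r.snd))).bind fun f =>
  PMF.pure (SS.ver n key.1 f.fst f.snd && decide ((f.fst, f.snd) ≠ (r.fst, sig)))

def OneTimeStronglyUnforgeable (SS : SignatureScheme) : Prop :=
  ∀ A₁ A₂ : Prog, A₁.PolyTime → A₂.PolyTime →
    Negligible fun n => (SS.otsuExperiment A₁ A₂ n true).toReal

end SignatureScheme

/-! ### Repetition -/

/-- A randomized encoding function with its decoding function. -/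
structure RandomizedEncoding where
  /-- the messages to be encoded -/
  msg : ℕ → Set Val
  /-- the random encoding `E(m; s)` of `m`, for random coins `s` -/
  encode : ℕ → Val → PMF Val
  /-- the decoding function -/
  decode : ℕ → Val → Option Val

structure RandomizedEncoding.Efficient (E : RandomizedEncoding) : Prop where
  encode : IsPPT (fun a : ℕ × Val => Val.pair (Val.unary a.1) a.2) fun a => E.encode a.1 a.2
  decode : IsPolyTime (fun a : ℕ × Val => Val.pair (Val.unary a.1) a.2)
    fun a => Val.ofOption (E.decode a.1 a.2)

open Classical in
/-- The `k`-repetition of a public-key encryption scheme: `k` independent key pairs; one encoding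
`E(m; s)`, encrypted under each of the `k` public keys with fresh coins; decryption gives `m` if the
ciphertext is a `k`-tuple all of whose components decrypt and decode to the same message `m`. -/
def PKE.repetition (S : PKE) (E : RandomizedEncoding) (k : ℕ → ℕ) : PKE where
  msg := E.msg
  gen n := (sampleList (List.replicate (k n) (S.gen n))).map fun keys =>
    (Val.ofList (keys.map Prod.fst), Val.ofList (keys.map Prod.snd))
  enc n pk m := (E.encode n m).bind fun e =>
    (sampleList (pk.toList.map fun pki => S.enc n pki e)).map Val.ofList
  dec n sk c :=
    if Val.ofList c.toList = c ∧ c.toList.length = k n then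
      let results := List.zipWith (fun ski ci => (S.dec n ski ci).bind (E.decode n))
        sk.toList c.toList
      match results with
      | some m :: _ => if m ∈ E.msg n ∧ ∀ r ∈ results, r = some m then some m else none
      | _ => none
    else none

/-- Verifiability under uniform `k`-repetition: there is a deterministic polynomial-time algorithm
`V` that, given a ciphertext `c = (c₁, …, cₖ)`, the public keys and a single secret key (the `i`-th
one), decides whether `c` decrypts to a message under all the secret keys. -/
def PKE.VerifiableRepetition (S : PKE) (E : RandomizedEncoding) (k : ℕ → ℕ) : Prop :=
  ∃ V : ℕ × Val × Val × ℕ × Val → Bool,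
    IsPolyTime
      (fun a : ℕ × Val × Val × ℕ × Val => Val.pair (Val.unary a.1) (Val.pair a.2.1
        (Val.pair a.2.2.1 (Val.pair (Val.unary a.2.2.2.1) a.2.2.2.2))))
      (fun a => Val.bit (V a)) ∧
    ∀ n, ∀ key ∈ ((S.repetition E k).gen n).support,
      ∀ c : List Val, c.length = k n →
        ∀ (i : ℕ) (ski : Val), key.2.toList[i]? = some ski →
          (V (n, Val.ofList c, key.1, i, ski) = true ↔
            ∃ m, (S.repetition E k).dec n key.2 (Val.ofList c) = some m)

/-! ### The construction -/

/-- The derived key: from the list of pairs `(keyᵢ⁰, keyᵢ¹)` and the bits `vkᵢ`, the list of the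
`keyᵢ ^ vkᵢ`. -/
def derivedKey (key : Val) (vk : List Bool) : Val :=
  Val.ofList (List.zipWith (fun a b => if b then Val.snd a else Val.fst a) key.toList vk)

/-- The scheme with `2k` key pairs; a ciphertext is `(c₀, (vk, σ))`, and whatever is not of this
form, with a `k`-bit string `vk`, is rejected. -/
def PKE.cca2 (S : PKE) (E : RandomizedEncoding) (SS : SignatureScheme) (k : ℕ → ℕ) : PKE where
  msg := E.msg
  gen n :=
    (sampleList (List.replicate (k n)
      ((S.gen n).bind fun key₀ => (S.gen n).bind fun key₁ => PMF.pure (key₀, key₁)))).map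
    fun keys => (Val.ofList (keys.map fun a => Val.pair a.1.1 a.2.1),
      Val.ofList (keys.map fun a => Val.pair a.1.2 a.2.2))
  enc n pk m :=
    (SS.gen n).bind fun skey =>
    ((S.repetition E k).enc n (derivedKey pk skey.1) m).bind fun c₀ =>
    (SS.sign n skey.2 c₀).bind fun sig =>
    PMF.pure (Val.pair c₀ (Val.pair (Val.ofBits skey.1) sig))
  dec n sk c :=
    match c with
    | Val.pair c₀ (Val.pair v sig) =>
      if Val.ofBits v.toBits = v ∧ v.toBits.length = k n then
        if SS.ver n v.toBits c₀ sig = true then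
          (S.repetition E k).dec n (derivedKey sk v.toBits) c₀
        else none
      else none
    | _ => none

end

/-! The signature keys `(vk, dsk)` of the challenge ciphertext may be drawn at the very start, since
nothing before the encryption depends on them. Of the `2k` key pairs let `A` be the `k` pairs at the
places selected by `vk`, and `B` the `k` others. The challenge is encrypted under `A` alone. A query
with a verification key other than `vk` differs from `vk` at some place `i`, so its `i`-th component
belongs to a key of `B`. By verifiability this one secret key decides whether all components decrypt
to a common message, and if they do, the `i`-th component yields that message. Hence the secret keys
of `B` suffice to answer every query, except those validly signed under `vk` itself (`simDec_eq`);
apart from the challenge, the latter are forgeries.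

The games with the real and with the simulated oracle therefore coincide on the outcomes without a
forgery (`realGame_apply_eq`), and their winning probabilities differ by at most the probability of
a forgery in the simulated game (`PMF.abs_sub_le_of_bad`). The real game is the IND-CCA2 experiment
(`cca2Experiment_eq`). The simulated game is the IND-CPA experiment of the repetition, for an
adversary that generates `B` and the signature keys itself (`cpaExperiment_eq`). A forgery in the
simulated game wins the one-time forgery experiment (`simGame_le_otsuExperiment`).

What remains is to show that these adversaries are programs of polynomial cost, on every input and
with every oracle. The predicates `PPT` and `DPT` on typed functions give a calculus for this, with
closure under composition, sampling and suitable loops. The delicate point is to run the IND-CCA2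
adversary with its oracle replaced by a program (`Prog.simulate`, `PPT.runLog`): its own cost bound
limits the number and the size of its queries. -/

namespace Val

/-! ### Sizes of values. -/

theorem one_le_size (v : Val) : 1 ≤ v.size := by
  cases v <;> simp [size]

theorem fst_size_le (v : Val) : v.fst.size ≤ v.size := by
  cases v <;> simp [fst, size]; omega

theorem snd_size_le (v : Val) : v.snd.size ≤ v.size := by
  cases v <;> simp [snd, size]; omega

@[simp] theorem fst_pair (a b : Val) : (pair a b).fst = a := rfl

@[simp] theorem snd_pair (a b : Val) : (pair a b).snd = b := rfl

@[simp] theorem toList_ofList (l : List Val) : (ofList l).toList = l := by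
  induction l with
  | nil => rfl
  | cons a l ih => simp [ofList, toList, ih]

theorem length_toList_lt_size (v : Val) : v.toList.length < v.size := by
  induction v with
  | nil => simp [toList, size]
  | bit b => simp [toList, size]
  | pair a b _ ih => simp [toList, size]; omega

theorem size_lt_of_mem_toList {v a : Val} (h : a ∈ v.toList) : a.size < v.size := by
  induction v with
  | nil => simp [toList] at h
  | bit b => simp [toList] at h
  | pair b c _ ih =>
    simp only [toList, List.mem_cons] at h
    rcases h with rfl | h
    · simp [size]
    · have := ih h
      simp [size]; omega

end Val

theorem Polynomial.eval_nat_mono (P : Polynomial ℕ) {a b : ℕ} (h : a ≤ b) :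
    P.eval a ≤ P.eval b := by
  simp only [Polynomial.eval_eq_sum, Polynomial.sum]
  exact Finset.sum_le_sum fun i _ => Nat.mul_le_mul_left _ (Nat.pow_le_pow_left h i)

namespace Prog

/-! ### Output distributions -/

section Output

variable (O : Val → Val) (x : Val) (c p q : Prog)

theorem outO_id : Prog.id.outO O x = PMF.pure x := by
  simp [outO, run, PMF.pure_map]

theorem outO_const (v : Val) : (const v).outO O x = PMF.pure v := by
  simp [outO, run, PMF.pure_map]

theorem outO_fst : Prog.fst.outO O x = PMF.pure x.fst := by
  simp [outO, run, PMF.pure_map]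

theorem outO_snd : Prog.snd.outO O x = PMF.pure x.snd := by
  simp [outO, run, PMF.pure_map]

theorem outO_eq : Prog.eq.outO O x = PMF.pure (Val.bit (decide (x.fst = x.snd))) := by
  simp [outO, run, PMF.pure_map]

theorem outO_sizeLe :
    Prog.sizeLe.outO O x = PMF.pure (Val.bit (decide (x.fst.size ≤ x.snd.size))) := by
  simp [outO, run, PMF.pure_map]

theorem outO_coin : Prog.coin.outO O x = fairCoin.map Val.bit := by
  simp [outO, run, PMF.map, PMF.bind_bind, Function.comp_def]

theorem outO_query : Prog.query.outO O x =
    PMF.pure (if (O x.fst).size ≤ x.snd.size then O x.fst else Val.nil) := by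
  simp [outO, run, PMF.pure_map]

theorem outO_comp : (comp p q).outO O x = (q.outO O x).bind fun y => p.outO O y := by
  simp [outO, run, PMF.map, PMF.bind_bind, Function.comp_def]

theorem outO_pair : (pair p q).outO O x =
    (p.outO O x).bind fun y => (q.outO O x).bind fun z => PMF.pure (Val.pair y z) := by
  simp [outO, run, PMF.map, PMF.bind_bind, Function.comp_def]

theorem outO_ite : (ite c p q).outO O x =
    (c.outO O x).bind fun y => if y = Val.bit true then p.outO O x else q.outO O x := by
  simp only [outO, run, PMF.map, PMF.bind_bind, Function.comp_def, PMF.pure_bind]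
  congr 1
  funext r
  split_ifs <;> rfl

/-- The output distribution of the loop of `fold`. -/
noncomputable def foldOut (step : Val → PMF Val) : List Val → Val → PMF Val
  | [], acc => PMF.pure acc
  | a :: l, acc => (step (Val.pair acc a)).bind fun r => foldOut step l r

theorem map_foldRun (step : Val → PMF (Val × ℕ)) (l : List Val) (acc : Val) :
    (foldRun step l acc).map Prod.fst = foldOut (fun y => (step y).map Prod.fst) l acc := by
  induction l generalizing acc with
  | nil => simp [foldRun, foldOut, PMF.pure_map]
  | cons a l ih =>
    simp only [PMF.map, Function.comp_def] at ih
    simp [foldRun, foldOut, PMF.map, PMF.bind_bind, Function.comp_def, ← ih]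

theorem outO_fold : (fold p).outO O x = foldOut (fun y => p.outO O y) x.snd.toList x.fst := by
  simp only [outO, run, ← map_foldRun]
  simp [PMF.map, PMF.bind_bind, Function.comp_def]

end Output

/-! ### Costs -/

/-- Every construct pays for its input, and an oracle answer that exceeds the space paid for is not
delivered. A bound on the cost is thus also a bound on the sizes of intermediate values, for any
oracle; composition of polynomial-time programs rests on this. -/
theorem size_le_cost (O : Val → Val) (p : Prog) (x : Val) {r : Val × ℕ}
    (hr : r ∈ (p.run O x).support) : r.1.size ≤ r.2 ∧ x.size + 1 ≤ r.2 := by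
  induction p generalizing x r with
  | id | const | eq | sizeLe =>
    simp only [run, PMF.support_pure, Set.mem_singleton_iff] at hr
    subst hr
    simp [Val.size] <;> omega
  | fst =>
    simp only [run, PMF.support_pure, Set.mem_singleton_iff] at hr
    subst hr
    have := x.fst_size_le
    simp; omega
  | snd =>
    simp only [run, PMF.support_pure, Set.mem_singleton_iff] at hr
    subst hr
    have := x.snd_size_le
    simp; omega
  | query =>
    simp only [run, PMF.support_pure, Set.mem_singleton_iff] at hr
    subst hr
    have := x.snd_size_le
    dsimp only
    split_ifs <;> simp [Val.size]
    omega
  | coin =>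
    simp only [run, PMF.mem_support_bind_iff, PMF.support_pure, Set.mem_singleton_iff] at hr
    obtain ⟨b, -, rfl⟩ := hr
    simp [Val.size]
  | comp p q ihp ihq =>
    simp only [run, PMF.mem_support_bind_iff, PMF.support_pure, Set.mem_singleton_iff] at hr
    obtain ⟨s, hs, t, ht, rfl⟩ := hr
    have := ihq _ hs
    have := ihp _ ht
    simp; omega
  | pair p q ihp ihq =>
    simp only [run, PMF.mem_support_bind_iff, PMF.support_pure, Set.mem_singleton_iff] at hr
    obtain ⟨s, hs, t, ht, rfl⟩ := hr
    have := ihp _ hs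
    have := ihq _ ht
    simp [Val.size]; omega
  | ite c p q ihc ihp ihq =>
    simp only [run, PMF.mem_support_bind_iff, PMF.support_pure, Set.mem_singleton_iff] at hr
    obtain ⟨s, hs, t, ht, rfl⟩ := hr
    have := ihc _ hs
    have : t.1.size ≤ t.2 := by
      split_ifs at ht
      · exact (ihp _ ht).1
      · exact (ihq _ ht).1
    simp; omega
  | fold p ih =>
    simp only [run, PMF.mem_support_bind_iff, PMF.support_pure, Set.mem_singleton_iff] at hr
    obtain ⟨s, hs, rfl⟩ := hr
    -- An empty loop costs nothing and returns its accumulator, so the size of the initial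
    -- accumulator has to be added.
    have key : ∀ (l : List Val) (acc : Val), ∀ s ∈ (foldRun (fun y => run O p y) l acc).support,
        s.1.size ≤ acc.size + s.2 := by
      intro l
      induction l with
      | nil =>
        intro acc s hs
        simp only [foldRun, PMF.support_pure, Set.mem_singleton_iff] at hs
        subst hs
        simp
      | cons a l ihl =>
        intro acc s hs
        simp only [foldRun, PMF.mem_support_bind_iff, PMF.support_pure,
          Set.mem_singleton_iff] at hs
        obtain ⟨r, hr, t, ht, rfl⟩ := hs
        have := (ih _ hr).1
        have := ihl _ _ ht
        dsimp only
        omega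
    have := key _ _ _ hs
    have := x.fst_size_le
    simp; omega

theorem polyTime_id : Prog.id.PolyTime := by
  refine ⟨1 + Polynomial.X, fun O x r hr => ?_⟩
  simp only [run, PMF.support_pure, Set.mem_singleton_iff] at hr
  simp [hr]

theorem polyTime_const (v : Val) : (const v).PolyTime := by
  refine ⟨1 + Polynomial.X + Polynomial.C v.size, fun O x r hr => ?_⟩
  simp only [run, PMF.support_pure, Set.mem_singleton_iff] at hr
  simp [hr]

theorem polyTime_fst : Prog.fst.PolyTime := by
  refine ⟨1 + Polynomial.X, fun O x r hr => ?_⟩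
  simp only [run, PMF.support_pure, Set.mem_singleton_iff] at hr
  simp [hr]

theorem polyTime_snd : Prog.snd.PolyTime := by
  refine ⟨1 + Polynomial.X, fun O x r hr => ?_⟩
  simp only [run, PMF.support_pure, Set.mem_singleton_iff] at hr
  simp [hr]

theorem polyTime_eq : Prog.eq.PolyTime := by
  refine ⟨1 + Polynomial.X, fun O x r hr => ?_⟩
  simp only [run, PMF.support_pure, Set.mem_singleton_iff] at hr
  simp [hr]

theorem polyTime_sizeLe : Prog.sizeLe.PolyTime := by
  refine ⟨1 + Polynomial.X, fun O x r hr => ?_⟩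
  simp only [run, PMF.support_pure, Set.mem_singleton_iff] at hr
  simp [hr]

theorem polyTime_coin : Prog.coin.PolyTime := by
  refine ⟨1 + Polynomial.X, fun O x r hr => ?_⟩
  simp only [run, PMF.mem_support_bind_iff, PMF.support_pure, Set.mem_singleton_iff] at hr
  obtain ⟨b, -, rfl⟩ := hr
  simp

theorem PolyTime.comp {p q : Prog} (hp : p.PolyTime) (hq : q.PolyTime) :
    (Prog.comp p q).PolyTime := by
  obtain ⟨P, hP⟩ := hp
  obtain ⟨Q, hQ⟩ := hq
  refine ⟨1 + Polynomial.X + Q + P.comp Q, fun O x r hr => ?_⟩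
  simp only [run, PMF.mem_support_bind_iff, PMF.support_pure, Set.mem_singleton_iff] at hr
  obtain ⟨s, hs, t, ht, rfl⟩ := hr
  have h1 := hQ O x s hs
  have h2 := hP O _ t ht
  have h3 := P.eval_nat_mono ((size_le_cost O q x hs).1.trans h1)
  simp [Polynomial.eval_comp]
  omega

theorem PolyTime.pair {p q : Prog} (hp : p.PolyTime) (hq : q.PolyTime) :
    (Prog.pair p q).PolyTime := by
  obtain ⟨P, hP⟩ := hp
  obtain ⟨Q, hQ⟩ := hq
  refine ⟨1 + Polynomial.X + P + Q, fun O x r hr => ?_⟩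
  simp only [run, PMF.mem_support_bind_iff, PMF.support_pure, Set.mem_singleton_iff] at hr
  obtain ⟨s, hs, t, ht, rfl⟩ := hr
  have h1 := hP O x s hs
  have h2 := hQ O x t ht
  simp
  omega

theorem PolyTime.ite {c p q : Prog} (hc : c.PolyTime) (hp : p.PolyTime) (hq : q.PolyTime) :
    (Prog.ite c p q).PolyTime := by
  obtain ⟨C, hC⟩ := hc
  obtain ⟨P, hP⟩ := hp
  obtain ⟨Q, hQ⟩ := hq
  refine ⟨1 + Polynomial.X + C + P + Q, fun O x r hr => ?_⟩
  simp only [run, PMF.mem_support_bind_iff, PMF.support_pure, Set.mem_singleton_iff] at hr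
  obtain ⟨s, hs, t, ht, rfl⟩ := hr
  have h1 := hC O x s hs
  have h2 : t.2 ≤ P.eval x.size + Q.eval x.size := by
    split_ifs at ht
    · exact (hP O x t ht).trans (Nat.le_add_right _ _)
    · exact (hQ O x t ht).trans (Nat.le_add_left _ _)
  simp
  omega

theorem fst_mem_support_outO {O : Val → Val} {p : Prog} {x : Val} {r : Val × ℕ}
    (hr : r ∈ (p.run O x).support) : r.1 ∈ (p.outO O x).support := by
  rw [outO, PMF.mem_support_map_iff]
  exact ⟨r, hr, rfl⟩

theorem PolyTime.exists_size_le {p : Prog} (hp : p.PolyTime) :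
    ∃ P : Polynomial ℕ, ∀ O x, ∀ y ∈ (p.outO O x).support, y.size ≤ P.eval x.size := by
  obtain ⟨P, hP⟩ := hp
  refine ⟨P, fun O x y hy => ?_⟩
  rw [outO, PMF.mem_support_map_iff] at hy
  obtain ⟨r, hr, rfl⟩ := hy
  exact (size_le_cost O p x hr).1.trans (hP O x r hr)

/-- A loop runs in polynomial time if its step does, as long as the accumulator stays of polynomial
size. -/
theorem PolyTime.fold {p : Prog} (hp : p.PolyTime) (R : Polynomial ℕ)
    (I : (Val → Val) → Val → ℕ → Val → Prop)
    (h₀ : ∀ O x, I O x 0 x.fst)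
    (hI : ∀ O x j acc, j < x.size → I O x j acc → acc.size ≤ R.eval x.size)
    (hstep : ∀ O x j acc, ∀ a ∈ x.snd.toList, j < x.size → I O x j acc →
      ∀ y ∈ (p.outO O (Val.pair acc a)).support, I O x (j + 1) y) :
    (Prog.fold p).PolyTime := by
  obtain ⟨P, hP⟩ := hp
  -- There are fewer than `x.size` iterations; each runs on a pair of an accumulator of size at most
  -- `R` and an entry smaller than `x`.
  refine ⟨1 + Polynomial.X + Polynomial.X * P.comp (R + Polynomial.X + 1), fun O x r hr => ?_⟩
  simp only [run, PMF.mem_support_bind_iff, PMF.support_pure, Set.mem_singleton_iff] at hr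
  obtain ⟨s, hs, rfl⟩ := hr
  have hlen := (x.snd.length_toList_lt_size).trans_le x.snd_size_le
  have key : ∀ (l : List Val) (j : ℕ) (acc : Val), (∀ a ∈ l, a ∈ x.snd.toList) →
      j + l.length < x.size → I O x j acc →
      ∀ s ∈ (foldRun (fun y => run O p y) l acc).support,
        s.2 ≤ l.length * P.eval (R.eval x.size + x.size + 1) := by
    intro l
    induction l with
    | nil =>
      intro j acc _ _ _ s hs
      simp only [foldRun, PMF.support_pure, Set.mem_singleton_iff] at hs
      subst hs
      simp
    | cons a l ihl =>
      intro j acc hl hj hacc s hs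
      simp only [foldRun, PMF.mem_support_bind_iff, PMF.support_pure,
        Set.mem_singleton_iff] at hs
      obtain ⟨r, hr, t, ht, rfl⟩ := hs
      simp only [List.length_cons] at hj
      have h1 := hI O x j acc (by omega) hacc
      have ha := hl a (by simp)
      have h2 := hstep O x j acc a ha (by omega) hacc r.1 (fst_mem_support_outO hr)
      have h3 := ihl (j + 1) r.1 (fun b hb => hl b (by simp [hb])) (by omega) h2 t ht
      have h4 := hP O _ r hr
      have h5 := Val.size_lt_of_mem_toList ha
      have h6 := x.snd_size_le
      have h7 : (Val.pair acc a).size ≤ R.eval x.size + x.size + 1 := by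
        simp [Val.size]; omega
      have h8 := P.eval_nat_mono h7
      simp only [List.length_cons, add_mul, one_mul]
      omega
  have h1 := key _ 0 _ (fun a ha => ha) (by simpa using hlen) (h₀ O x) s hs
  have h2 := Nat.mul_le_mul_right (P.eval (R.eval x.size + x.size + 1)) hlen.le
  simp [Polynomial.eval_comp]
  omega

/-! ### Derandomization -/

/-- The program with its coins replaced by some arbitrary bits. -/
def derandomize : Prog → Prog
  -- Like `coin`, `eq` returns a bit at cost `1 + size`, but without randomness.
  | coin => Prog.eq
  | comp p q => comp p.derandomize q.derandomize
  | pair p q => pair p.derandomize q.derandomize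
  | ite c p q => ite c.derandomize p.derandomize q.derandomize
  | fold p => fold p.derandomize
  | p => p

/-- Fixing the outcomes of the coins singles out one of the possible runs. The cost bound is
inherited, and so is the output wherever it does not depend on the coins. -/
theorem derandomize_run (O : Val → Val) (p : Prog) (x : Val) :
    ∃ r ∈ (p.run O x).support, p.derandomize.run O x = PMF.pure r := by
  induction p generalizing x with
  | id | const | fst | snd | eq | sizeLe | query =>
    exact ⟨_, (PMF.mem_support_pure_iff _ _).2 rfl, rfl⟩
  | coin =>
    refine ⟨_, ?_, rfl⟩
    simp [run, fairCoin, em']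
  | comp p q ihp ihq =>
    obtain ⟨s, hs, hs'⟩ := ihq x
    obtain ⟨t, ht, ht'⟩ := ihp s.1
    refine ⟨(t.1, 1 + x.size + s.2 + t.2), ?_, ?_⟩
    · simp only [run, PMF.mem_support_bind_iff, PMF.support_pure, Set.mem_singleton_iff]
      exact ⟨s, hs, t, ht, rfl⟩
    · simp [derandomize, run, hs', ht']
  | pair p q ihp ihq =>
    obtain ⟨s, hs, hs'⟩ := ihp x
    obtain ⟨t, ht, ht'⟩ := ihq x
    refine ⟨(Val.pair s.1 t.1, 1 + x.size + s.2 + t.2), ?_, ?_⟩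
    · simp only [run, PMF.mem_support_bind_iff, PMF.support_pure, Set.mem_singleton_iff]
      exact ⟨s, hs, t, ht, rfl⟩
    · simp [derandomize, run, hs', ht']
  | ite c p q ihc ihp ihq =>
    obtain ⟨s, hs, hs'⟩ := ihc x
    obtain ⟨t, ht, ht'⟩ : ∃ t ∈ (if s.1 = Val.bit true then run O p x else run O q x).support,
        (if s.1 = Val.bit true then run O p.derandomize x else run O q.derandomize x) =
          PMF.pure t := by
      split_ifs
      · exact ihp x
      · exact ihq x
    refine ⟨(t.1, 1 + x.size + s.2 + t.2), ?_, ?_⟩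
    · simp only [run, PMF.mem_support_bind_iff, PMF.support_pure, Set.mem_singleton_iff]
      exact ⟨s, hs, t, ht, rfl⟩
    · simp [derandomize, run, hs', ht']
  | fold p ih =>
    have key : ∀ (l : List Val) (acc : Val),
        ∃ r ∈ (foldRun (fun y => run O p y) l acc).support,
          foldRun (fun y => run O p.derandomize y) l acc = PMF.pure r := by
      intro l
      induction l with
      | nil => exact fun acc => ⟨_, (PMF.mem_support_pure_iff _ _).2 rfl, rfl⟩
      | cons a l ihl =>
        intro acc
        obtain ⟨s, hs, hs'⟩ := ih (Val.pair acc a)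
        obtain ⟨t, ht, ht'⟩ := ihl s.1
        refine ⟨(t.1, s.2 + t.2), ?_, ?_⟩
        · simp only [foldRun, PMF.mem_support_bind_iff, PMF.support_pure, Set.mem_singleton_iff]
          exact ⟨s, hs, t, ht, rfl⟩
        · simp [foldRun, hs', ht']
    obtain ⟨s, hs, hs'⟩ := key x.snd.toList x.fst
    refine ⟨(s.1, 1 + x.size + s.2), ?_, ?_⟩
    · simp only [run, PMF.mem_support_bind_iff, PMF.support_pure, Set.mem_singleton_iff]
      exact ⟨s, hs, rfl⟩
    · simp [derandomize, run, hs']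

theorem PolyTime.derandomize {p : Prog} (hp : p.PolyTime) : p.derandomize.PolyTime := by
  obtain ⟨P, hP⟩ := hp
  refine ⟨P, fun O x r hr => ?_⟩
  obtain ⟨s, hs, h⟩ := derandomize_run O p x
  rw [h, PMF.support_pure, Set.mem_singleton_iff] at hr
  exact hr ▸ hP O x s hs

/-- The value computed by a derandomized program. -/
noncomputable def value (O : Val → Val) (p : Prog) (x : Val) : Val := (derandomize_run O p x).choose.1

theorem derandomize_outO (O : Val → Val) (p : Prog) (x : Val) :
    p.derandomize.outO O x = PMF.pure (p.value O x) := by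
  have h := (derandomize_run O p x).choose_spec.2
  rw [outO, h, PMF.pure_map]
  rfl

theorem derandomize_run_support {O : Val → Val} {p : Prog} {x : Val} {r : Val × ℕ}
    (hr : r ∈ (p.derandomize.run O x).support) : r.1 = p.value O x := by
  have h := (derandomize_run O p x).choose_spec.2
  rw [h, PMF.support_pure, Set.mem_singleton_iff] at hr
  rw [hr]
  rfl

theorem value_eq_of_outO_eq_pure {O : Val → Val} {p : Prog} {x y : Val}
    (h : p.outO O x = PMF.pure y) : p.value O x = y := by
  have h1 := (derandomize_run O p x).choose_spec.1
  have h2 : p.value O x ∈ (p.outO O x).support := by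
    rw [outO, PMF.mem_support_map_iff]
    exact ⟨_, h1, rfl⟩
  rwa [h, PMF.mem_support_pure_iff] at h2

end Prog

namespace Prog

theorem foldOut_pure_append (l : List Val) (f : Val → Val) (acc : Val) :
    foldOut (fun y => PMF.pure (f y)) l acc =
      PMF.pure (l.foldl (fun s a => f (Val.pair s a)) acc) := by
  induction l generalizing acc with
  | nil => rfl
  | cons a l ih => simp [foldOut, ih]

/-! ### Reversal of a list -/

/-- Reverses a list. -/
def reverseList : Prog := comp (fold (pair snd fst)) (pair (const Val.nil) id)

theorem reverseList_outO (O : Val → Val) (x : Val) :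
    reverseList.outO O x = PMF.pure (Val.ofList x.toList.reverse) := by
  have h : ∀ (l l' : List Val),
      l.foldl (fun s a => Val.pair a s) (Val.ofList l') = Val.ofList (l.reverse ++ l') := by
    intro l
    induction l with
    | nil => simp
    | cons a l ih => intro l'; simpa [Val.ofList] using ih (a :: l')
  simp only [reverseList, outO_comp, outO_pair, outO_const, outO_id, outO_fold, outO_snd, outO_fst,
    PMF.pure_bind, Val.fst_pair, Val.snd_pair]
  rw [foldOut_pure_append (f := fun y => Val.pair y.snd y.fst)]
  simpa [Val.ofList] using congrArg PMF.pure (h x.toList [])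

theorem polyTime_reverseList : reverseList.PolyTime := by
  refine PolyTime.comp ?_ ((polyTime_const _).pair polyTime_id)
  refine (polyTime_snd.pair polyTime_fst).fold
    (Polynomial.X + Polynomial.X * (Polynomial.X + 1))
    (fun _ x j acc => acc.size ≤ x.size + j * (x.size + 1)) ?_ ?_ ?_
  · intro _ x
    simpa using x.fst_size_le
  · intro O x j acc hj h
    have := Nat.mul_le_mul_right (x.size + 1) hj.le
    simp
    omega
  · intro O x j acc a ha hj h y hy
    simp only [outO_pair, outO_fst, outO_snd, PMF.pure_bind, PMF.support_pure,
      Set.mem_singleton_iff] at hy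
    have := Val.size_lt_of_mem_toList ha
    have := x.snd_size_le
    subst hy
    simp [Val.size, add_mul]
    omega

/-! ### Applying a program to the entries of a list -/

/-- On input `(c, l)`, lists the results of `p` on the `(c, a)` for `a` in `l`. -/
def mapList (p : Prog) : Prog :=
  comp reverseList (comp snd (comp
    (fold (pair (comp fst fst) (pair (comp p (pair (comp fst fst) snd)) (comp snd fst))))
    (pair (pair fst (const Val.nil)) snd)))

theorem mapList_outO (O : Val → Val) (p : Prog) (c l : Val) :
    (mapList p).outO O (Val.pair c l) =
      (sampleList (l.toList.map fun a => p.outO O (Val.pair c a))).map Val.ofList := by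
  simp only [mapList, outO_comp, outO_pair, outO_const, outO_fold, outO_snd, outO_fst,
    PMF.pure_bind, Val.fst_pair, Val.snd_pair, PMF.bind_bind, reverseList_outO]
  -- The results are collected in reverse order, behind the constant `c`; the induction needs an
  -- arbitrary list `o` of earlier results.
  have h : ∀ (l o : List Val),
      (foldOut (fun y => (p.outO O (Val.pair y.fst.fst y.snd)).bind fun z =>
          PMF.pure (Val.pair y.fst.fst (Val.pair z y.fst.snd))) l
        (Val.pair c (Val.ofList o))).bind
        (fun y => PMF.pure (Val.ofList y.snd.toList.reverse)) =
      (sampleList (l.map fun a => p.outO O (Val.pair c a))).map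
        (fun bs => Val.ofList (o.reverse ++ bs)) := by
    intro l
    induction l with
    | nil => intro o; simp [foldOut, sampleList, PMF.pure_map]
    | cons a l ih =>
      intro o
      have ih' := fun z => ih (z :: o)
      simp only [Val.ofList] at ih'
      simp only [foldOut, Val.fst_pair, Val.snd_pair, PMF.bind_bind, PMF.pure_bind, ih',
        sampleList, List.map_cons, PMF.map, Function.comp_def]
      simp
  simpa [Val.ofList] using h l.toList []

theorem PolyTime.mapList {p : Prog} (hp : p.PolyTime) : (mapList p).PolyTime := by
  obtain ⟨P, hP⟩ := hp.exists_size_le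
  refine polyTime_reverseList.comp (polyTime_snd.comp (PolyTime.comp ?_
    ((polyTime_fst.pair (polyTime_const _)).pair polyTime_snd)))
  refine PolyTime.fold ((polyTime_fst.comp polyTime_fst).pair ((hp.comp
    ((polyTime_fst.comp polyTime_fst).pair polyTime_snd)).pair (polyTime_snd.comp polyTime_fst)))
    (Polynomial.X + Polynomial.X * (3 + P.comp (2 * Polynomial.X + 1)))
    -- As the constant in front never changes, the argument of `p` has size at most `2 * x.size + 1`
    -- in every step, and each result adds a fixed amount.
    (fun _ x j acc => acc.fst = x.fst.fst ∧
      acc.size ≤ x.size + j * (3 + P.eval (2 * x.size + 1))) ?_ ?_ ?_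
  · intro _ x
    simpa using x.fst_size_le
  · intro O x j acc hj h
    have := Nat.mul_le_mul_right (3 + P.eval (2 * x.size + 1)) hj.le
    simp [Polynomial.eval_comp]
    omega
  · intro O x j acc a ha hj h y hy
    simp only [outO_pair, outO_comp, outO_fst, outO_snd, PMF.pure_bind, PMF.mem_support_bind_iff,
      Val.fst_pair, Val.snd_pair, PMF.bind_bind, PMF.support_pure, Set.mem_singleton_iff] at hy
    obtain ⟨z, hz, rfl⟩ := hy
    refine ⟨h.1, ?_⟩
    have h1 := hP _ _ z hz
    have h2 := Val.size_lt_of_mem_toList ha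
    have h3 := x.snd_size_le
    have h4 : (Val.pair acc.fst a).size ≤ 2 * x.size + 1 := by
      have := x.fst_size_le
      have := x.fst.fst_size_le
      simp [Val.size, h.1]
      omega
    have h5 := P.eval_nat_mono h4
    have h6 : acc.fst.size + acc.snd.size ≤ acc.size + 1 := by
      cases acc <;> simp [Val.fst, Val.snd, Val.size]
      omega
    have h7 := h.2
    simp [Val.size, add_mul] at h7 ⊢
    omega

/-! ### Loops with an accumulator of bounded size -/

/-- A value that is `2 ^ j` times as long as the input. -/
def enlarge : ℕ → Prog
  | 0 => id
  | j + 1 => comp (pair id id) (enlarge j)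

theorem polyTime_enlarge (j : ℕ) : (enlarge j).PolyTime := by
  induction j with
  | zero => exact polyTime_id
  | succ j ih => exact (polyTime_id.pair polyTime_id).comp ih

theorem enlarge_outO (O : Val → Val) (j : ℕ) (x : Val) :
    ∃ y, (enlarge j).outO O x = PMF.pure y ∧ (j + 1) * x.size ≤ y.size := by
  induction j with
  | zero => exact ⟨x, outO_id O x, by simp⟩
  | succ j ih =>
    obtain ⟨y, hy, hy'⟩ := ih
    refine ⟨Val.pair y y, by simp [enlarge, outO_comp, outO_pair, outO_id, hy], ?_⟩
    have : x.size ≤ y.size := (Nat.le_mul_of_pos_left _ (by omega)).trans hy'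
    simp only [Val.size]
    linarith

/-- The body of `boundedFold`, on an input `(((c, bound), s), a)`. -/
def boundedStep (p : Prog) : Prog :=
  pair (comp fst fst) (comp (ite sizeLe fst (const Val.nil))
    (pair (comp p (pair (comp fst (comp fst fst)) (pair (comp snd fst) snd)))
      (comp snd (comp fst fst))))

/-- On input `(c, (s, l))`, the loop updating `s` to `p (c, (s, a))` for `a` in `l`, provided the
size stays below some multiple of the size of the input. -/
def boundedFold (j : ℕ) (p : Prog) : Prog :=
  comp snd (comp (fold (boundedStep p))
    (pair (pair (pair fst (enlarge j)) (comp fst snd)) (comp snd snd)))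

theorem boundedStep_outO (O : Val → Val) (p : Prog) (x : Val) :
    (boundedStep p).outO O x =
      (p.outO O (Val.pair x.fst.fst.fst (Val.pair x.fst.snd x.snd))).map fun y =>
        Val.pair x.fst.fst (if y.size ≤ x.fst.fst.snd.size then y else Val.nil) := by
  simp only [boundedStep, outO_comp, outO_pair, outO_const, outO_ite, outO_sizeLe, outO_snd,
    outO_fst, PMF.pure_bind, Val.fst_pair, Val.snd_pair, PMF.bind_bind, PMF.map, Function.comp_def]
  congr 1
  funext y
  by_cases h : y.size ≤ x.fst.fst.snd.size <;> simp [h]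

/-- `PolyTime` concerns all inputs, also those that code nothing sensible and might make the
accumulator grow exponentially. Cutting it off at the size of `bound` keeps every step within a
fixed multiple of the input. -/
theorem PolyTime.boundedFold (j : ℕ) {p : Prog} (hp : p.PolyTime) :
    (boundedFold j p).PolyTime := by
  refine polyTime_snd.comp (PolyTime.comp ?_ (((polyTime_fst.pair (polyTime_enlarge j)).pair
    (polyTime_fst.comp polyTime_snd)).pair (polyTime_snd.comp polyTime_snd)))
  have hstep : (boundedStep p).PolyTime :=
    (polyTime_fst.comp polyTime_fst).pair
      ((polyTime_sizeLe.ite polyTime_fst (polyTime_const _)).comp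
        ((hp.comp ((polyTime_fst.comp (polyTime_fst.comp polyTime_fst)).pair
          ((polyTime_snd.comp polyTime_fst).pair polyTime_snd))).pair
          (polyTime_snd.comp (polyTime_fst.comp polyTime_fst))))
  refine hstep.fold (2 * Polynomial.X + 1)
    (fun _ x _ acc => acc.fst = x.fst.fst ∧ acc.size ≤ 2 * x.size + 1) ?_ ?_ ?_
  · intro _ x
    have := x.fst_size_le
    exact ⟨rfl, by omega⟩
  · intro O x j acc hj h
    simpa using h.2
  · intro O x j acc a ha hj h y hy
    rw [boundedStep_outO, PMF.mem_support_map_iff] at hy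
    obtain ⟨z, hz, rfl⟩ := hy
    refine ⟨h.1, ?_⟩
    have h1 := x.fst_size_le
    have h2 := x.fst.fst_size_le
    have h3 := x.fst.fst.snd_size_le
    have h4 := x.one_le_size
    simp only [Val.fst_pair, h.1, Val.size]
    split_ifs
    · omega
    · simp only [Val.size]; omega

end Prog

/-! ### Typed algorithms -/

/-- The types whose elements are written as values. -/
class Coded (α : Type) where
  code : α → Val

open Coded

instance : Coded Val := ⟨fun v => v⟩
instance : Coded Bool := ⟨Val.bit⟩
instance : Coded ℕ := ⟨Val.unary⟩

section

variable {α β γ δ σ : Type} [Coded α] [Coded β] [Coded γ] [Coded δ] [Coded σ]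

instance : Coded (α × β) := ⟨fun a => Val.pair (code a.1) (code a.2)⟩
instance : Coded (List α) := ⟨fun l => Val.ofList (l.map code)⟩
instance : Coded (Option α) := ⟨fun o => Val.ofOption (o.map code)⟩

theorem code_val (v : Val) : code v = v := rfl
theorem code_bool (b : Bool) : code b = Val.bit b := rfl
theorem code_prod (a : α × β) : code a = Val.pair (code a.1) (code a.2) := rfl
theorem code_list (l : List α) : code l = Val.ofList (l.map code) := rfl
theorem code_nil : code ([] : List α) = Val.nil := rfl
theorem code_cons (a : α) (l : List α) : code (a :: l) = Val.pair (code a) (code l) := rfl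
theorem code_none : code (none : Option α) = Val.nil := rfl
theorem code_some (a : α) : code (some a) = Val.pair Val.nil (code a) := rfl
theorem toList_code (l : List α) : (code l).toList = l.map code := Val.toList_ofList _
theorem code_list_val (l : List Val) : code l = Val.ofList l := by
  rw [code_list]
  congr 1
  exact List.map_id l

/-- `f` is computed by a probabilistic polynomial-time algorithm. -/
def PPT (f : α → PMF β) : Prop := ∃ p : Prog, p.PolyTime ∧ ∀ a, p.out (code a) = (f a).map code

/-- `f` is computed in polynomial time. -/
@[fun_prop]
def DPT (f : α → β) : Prop := PPT fun a => PMF.pure (f a)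

theorem DPT.of_prog {f : α → β} (p : Prog) (hp : p.PolyTime)
    (h : ∀ a, p.out (code a) = PMF.pure (code (f a))) : DPT f :=
  ⟨p, hp, fun a => by rw [h, PMF.pure_map]⟩

theorem PPT.bind {f : α → PMF β} {g : β → PMF γ} (hf : PPT f) (hg : PPT g) :
    PPT fun a => (f a).bind g := by
  obtain ⟨p, hp, hp'⟩ := hf
  obtain ⟨q, hq, hq'⟩ := hg
  refine ⟨Prog.comp q p, hq.comp hp, fun a => ?_⟩
  simp only [Prog.out] at hp' hq' ⊢
  rw [Prog.outO_comp, hp', PMF.bind_map, PMF.map_bind]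
  simp only [Function.comp_def, hq']

theorem PPT.comp {g : β → PMF γ} {f : α → β} (hg : PPT g) (hf : DPT f) :
    PPT fun a => g (f a) := by
  simpa using PPT.bind hf hg

theorem PPT.map {f : α → PMF β} {g : β → γ} (hf : PPT f) (hg : DPT g) :
    PPT fun a => (f a).map g := hf.bind hg

theorem PPT.prodMk {f : α → PMF β} {g : α → PMF γ} (hf : PPT f) (hg : PPT g) :
    PPT fun a => (f a).bind fun b => (g a).bind fun c => PMF.pure (b, c) := by
  obtain ⟨p, hp, hp'⟩ := hf
  obtain ⟨q, hq, hq'⟩ := hg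
  refine ⟨Prog.pair p q, hp.pair hq, fun a => ?_⟩
  simp only [Prog.out] at hp' hq' ⊢
  simp [Prog.outO_pair, hp', hq', PMF.map, Function.comp_def, code_prod]

@[fun_prop]
theorem dpt_id : DPT fun a : α => a :=
  DPT.of_prog Prog.id Prog.polyTime_id fun _ => Prog.outO_id _ _

@[fun_prop]
theorem dpt_const (b : β) : DPT fun _ : α => b :=
  DPT.of_prog (Prog.const (code b)) (Prog.polyTime_const _) fun _ => Prog.outO_const _ _ _

@[fun_prop]
theorem DPT.comp {g : β → γ} {f : α → β} (hg : DPT g) (hf : DPT f) : DPT fun a => g (f a) :=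
  PPT.comp (g := fun b => PMF.pure (g b)) hg hf

@[fun_prop]
theorem DPT.prodMk {f : α → β} {g : α → γ} (hf : DPT f) (hg : DPT g) :
    DPT fun a => (f a, g a) := by
  have h := PPT.prodMk hf hg
  simp only [PMF.pure_bind] at h
  exact h

@[fun_prop]
theorem dpt_fst : DPT fun a : α × β => a.1 :=
  DPT.of_prog Prog.fst Prog.polyTime_fst fun _ => Prog.outO_fst _ _

@[fun_prop]
theorem dpt_snd : DPT fun a : α × β => a.2 :=
  DPT.of_prog Prog.snd Prog.polyTime_snd fun _ => Prog.outO_snd _ _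

/-- Sampling followed by an algorithm that still has the original input. -/
theorem PPT.bind_prod {f : α → PMF β} {g : α × β → PMF γ} (hf : PPT f) (hg : PPT g) :
    PPT fun a => (f a).bind fun b => g (a, b) := by
  simpa using (PPT.prodMk (dpt_id (α := α)) hf).bind hg

theorem PPT.cond {c : α → Bool} {f g : α → PMF β} (hc : DPT c) (hf : PPT f) (hg : PPT g) :
    PPT fun a => bif c a then f a else g a := by
  obtain ⟨r, hr, hr'⟩ := hc
  obtain ⟨p, hp, hp'⟩ := hf
  obtain ⟨q, hq, hq'⟩ := hg
  refine ⟨Prog.ite r p q, hr.ite hp hq, fun a => ?_⟩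
  simp only [Prog.out, PMF.pure_map] at hp' hq' hr' ⊢
  rw [Prog.outO_ite, hr', PMF.pure_bind, hp', hq', code_bool]
  cases c a <;> simp

@[fun_prop]
theorem DPT.cond {c : α → Bool} {f g : α → β} (hc : DPT c) (hf : DPT f) (hg : DPT g) :
    DPT fun a => bif c a then f a else g a := by
  have h := PPT.cond hc hf hg
  have h' : (fun a => bif c a then PMF.pure (f a) else PMF.pure (g a)) =
      fun a => PMF.pure (bif c a then f a else g a) := by
    funext a
    cases c a <;> rfl
  rw [h'] at h
  exact h

theorem ppt_fairCoin : PPT fun _ : α => fairCoin :=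
  ⟨Prog.coin, Prog.polyTime_coin, fun _ => Prog.outO_coin _ _⟩

@[fun_prop]
theorem DPT.and {f g : α → Bool} (hf : DPT f) (hg : DPT g) : DPT fun a => f a && g a := by
  have h : (fun a => f a && g a) = fun a => bif f a then g a else false := by
    funext a
    cases f a <;> rfl
  rw [h]
  fun_prop

@[fun_prop]
theorem DPT.not {f : α → Bool} (hf : DPT f) : DPT fun a => !f a := by
  have h : (fun a => !f a) = fun a => bif f a then false else true := by
    funext a
    cases f a <;> rfl
  rw [h]
  fun_prop

@[fun_prop]
theorem DPT.beq_val {f g : α → Val} (hf : DPT f) (hg : DPT g) :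
    DPT fun a => decide (f a = g a) := by
  have h : DPT fun a : Val × Val => decide (a.1 = a.2) :=
    DPT.of_prog Prog.eq Prog.polyTime_eq fun _ => Prog.outO_eq _ _
  exact h.comp (hf.prodMk hg)

@[fun_prop]
theorem dpt_code : DPT fun a : α => code a :=
  DPT.of_prog Prog.id Prog.polyTime_id fun _ => Prog.outO_id _ _

@[fun_prop]
theorem dpt_val_fst : DPT Val.fst :=
  DPT.of_prog Prog.fst Prog.polyTime_fst fun _ => Prog.outO_fst _ _

@[fun_prop]
theorem dpt_val_snd : DPT Val.snd :=
  DPT.of_prog Prog.snd Prog.polyTime_snd fun _ => Prog.outO_snd _ _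

@[fun_prop]
theorem DPT.val_pair {f g : α → Val} (hf : DPT f) (hg : DPT g) :
    DPT fun a => Val.pair (f a) (g a) :=
  (dpt_code (α := Val × Val)).comp (hf.prodMk hg)

@[fun_prop]
theorem DPT.some {f : α → β} (hf : DPT f) : DPT fun a => some (f a) := by
  have h : DPT fun b : β => Option.some b :=
    DPT.of_prog (Prog.pair (Prog.const Val.nil) Prog.id)
      ((Prog.polyTime_const _).pair Prog.polyTime_id) fun b => by
        simp [Prog.out, Prog.outO_pair, Prog.outO_const, Prog.outO_id, code_some]
  exact h.comp hf

/-- `none` is coded by `nil` and `some b` by a pair, so one equality test tells the cases apart. -/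
theorem PPT.option_elim {o : α → Option β} {f : α → PMF γ} {g : α × β → PMF γ} (ho : DPT o)
    (hf : PPT f) (hg : PPT g) : PPT fun a => (o a).elim (f a) fun b => g (a, b) := by
  obtain ⟨r, hr, hr'⟩ := ho
  obtain ⟨p, hp, hp'⟩ := hf
  obtain ⟨q, hq, hq'⟩ := hg
  refine ⟨Prog.ite (Prog.comp Prog.eq (Prog.pair r (Prog.const Val.nil))) p
    (Prog.comp q (Prog.pair Prog.id (Prog.comp Prog.snd r))),
    (Prog.polyTime_eq.comp (hr.pair (Prog.polyTime_const _))).ite hp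
      (hq.comp (Prog.polyTime_id.pair (Prog.polyTime_snd.comp hr))), fun a => ?_⟩
  simp only [Prog.out, PMF.pure_map] at hp' hq' hr' ⊢
  simp only [Prog.outO_ite, Prog.outO_comp, Prog.outO_pair, hr', Prog.outO_const, PMF.pure_bind,
    Prog.outO_eq, Prog.outO_id, Prog.outO_snd, Val.fst_pair, Val.snd_pair, hp']
  cases o a with
  | none => simp [code_none]
  | some b => simpa [code_some, code_prod] using hq' (a, b)

@[fun_prop]
theorem DPT.option_elim {o : α → Option β} {f : α → γ} {g : α → β → γ} (ho : DPT o)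
    (hf : DPT f) (hg : DPT fun a : α × β => g a.1 a.2) :
    DPT fun a => (o a).elim (f a) (g a) := by
  have h := PPT.option_elim ho hf hg
  have h' : (fun a => (o a).elim (PMF.pure (f a)) fun b => PMF.pure (g a b)) =
      fun a => PMF.pure ((o a).elim (f a) (g a)) := by
    funext a
    cases o a <;> rfl
  rw [h'] at h
  exact h

/-! ### Lists -/

theorem sampleList_map_map {α β : Type} (l : List (PMF α)) (f : α → β) :
    sampleList (l.map fun p => p.map f) = (sampleList l).map (List.map f) := by
  induction l with
  | nil => simp [sampleList, PMF.pure_map]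
  | cons p l ih =>
    simp only [List.map_cons, sampleList, ih]
    simp [PMF.map, PMF.bind_bind, Function.comp_def]

theorem sampleList_map_pure {α β : Type} (l : List α) (f : α → β) :
    sampleList (l.map fun a => PMF.pure (f a)) = PMF.pure (l.map f) := by
  induction l with
  | nil => rfl
  | cons p l ih => simp [sampleList, ih]

@[fun_prop]
theorem DPT.cons {f : α → β} {g : α → List β} (hf : DPT f) (hg : DPT g) :
    DPT fun a => f a :: g a := by
  have h : DPT fun a : β × List β => a.1 :: a.2 :=
    DPT.of_prog Prog.id Prog.polyTime_id fun _ => Prog.outO_id _ _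
  exact h.comp (hf.prodMk hg)

@[fun_prop]
theorem dpt_tail : DPT fun l : List α => l.tail :=
  DPT.of_prog Prog.snd Prog.polyTime_snd fun l => by
    rw [Prog.out, Prog.outO_snd]
    cases l <;> rfl

@[fun_prop]
theorem dpt_head? : DPT fun l : List α => l.head? :=
  DPT.of_prog (Prog.ite (Prog.comp Prog.eq (Prog.pair Prog.id (Prog.const Val.nil)))
    (Prog.const Val.nil) (Prog.pair (Prog.const Val.nil) Prog.fst))
    ((Prog.polyTime_eq.comp (Prog.polyTime_id.pair (Prog.polyTime_const _))).ite
      (Prog.polyTime_const _) ((Prog.polyTime_const _).pair Prog.polyTime_fst)) fun l => by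
    simp only [Prog.out, Prog.outO_ite, Prog.outO_comp, Prog.outO_pair, Prog.outO_const,
      PMF.pure_bind, Prog.outO_eq, Prog.outO_id, Prog.outO_fst, Val.fst_pair, Val.snd_pair]
    cases l <;> simp [code_nil, code_cons, code_none, code_some]

@[fun_prop]
theorem dpt_reverse : DPT fun l : List α => l.reverse :=
  DPT.of_prog Prog.reverseList Prog.polyTime_reverseList fun l => by
    rw [Prog.out, Prog.reverseList_outO, toList_code, code_list, List.map_reverse]

@[fun_prop]
theorem dpt_toList : DPT Val.toList :=
  DPT.of_prog (Prog.comp (Prog.mapList Prog.snd) (Prog.pair Prog.id Prog.id))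
    (Prog.polyTime_snd.mapList.comp (Prog.polyTime_id.pair Prog.polyTime_id)) fun v => by
    simp only [Prog.out, Prog.outO_comp, Prog.outO_pair, Prog.outO_id, PMF.pure_bind,
      Prog.mapList_outO, Prog.outO_snd, Val.snd_pair, sampleList_map_pure (f := fun a : Val => a),
      PMF.pure_map, code_list_val, List.map_id_fun']
    rfl

/-- Independent executions of a randomized algorithm on the entries of a list. -/
theorem PPT.sampleList_map {f : α × β → PMF γ} {l : α → List β} (hf : PPT f) (hl : DPT l) :
    PPT fun a => sampleList ((l a).map fun b => f (a, b)) := by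
  have h : PPT fun a : α × List β => sampleList (a.2.map fun b => f (a.1, b)) := by
    obtain ⟨p, hp, hp'⟩ := hf
    refine ⟨Prog.mapList p, hp.mapList, fun a => ?_⟩
    simp only [Prog.out] at hp' ⊢
    rw [code_prod, Prog.mapList_outO, toList_code, List.map_map]
    have : (fun b => p.outO (fun _ => Val.nil) (Val.pair (code a.1) b)) ∘ code =
        (fun μ : PMF γ => μ.map code) ∘ fun b => f (a.1, b) := by
      funext b
      exact hp' (a.1, b)
    rw [this, ← List.map_map, sampleList_map_map, PMF.map_comp]
    rfl
  exact h.comp (dpt_id.prodMk hl)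

@[fun_prop]
theorem DPT.map {f : α → β → γ} {l : α → List β} (hf : DPT fun a : α × β => f a.1 a.2)
    (hl : DPT l) : DPT fun a => (l a).map (f a) := by
  have h := PPT.sampleList_map hf hl
  simp only [sampleList_map_pure] at h
  exact h

/-- Loops whose accumulator grows, in each step, by a multiple of the size of the list entry. -/
theorem DPT.foldl {f : α → σ → β → σ} {s : α → σ} {l : α → List β}
    (hf : DPT fun a : α × σ × β => f a.1 a.2.1 a.2.2) (hs : DPT s) (hl : DPT l) (C : ℕ)
    (hC : ∀ a s b, (code (f a s b)).size ≤ (code s).size + C * ((code b).size + 1)) :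
    DPT fun a => (l a).foldl (f a) (s a) := by
  have h : DPT fun a : α × σ × List β => a.2.2.foldl (f a.1) a.2.1 := by
    obtain ⟨p, hp, hp'⟩ := hf
    refine DPT.of_prog (Prog.boundedFold C p) (hp.boundedFold C) fun a => ?_
    simp only [Prog.out, PMF.pure_map] at hp' ⊢
    obtain ⟨B, hB, hB'⟩ := Prog.enlarge_outO (fun _ => Val.nil) C (code a)
    simp only [Prog.boundedFold, Prog.outO_comp, Prog.outO_pair, Prog.outO_fst, Prog.outO_snd, hB,
      PMF.pure_bind, Prog.outO_fold, Val.fst_pair, Val.snd_pair, Prog.boundedStep_outO]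
    simp only [code_prod, Val.fst_pair, Val.snd_pair, toList_code]
    -- The sum of the size of the accumulator and `C` times the size of the remaining list does not
    -- increase. On genuine codes it starts below the size of `B`, so nothing is ever cut off.
    have key : ∀ (l : List β) (s : σ), (code s).size + C * (code l).size ≤ B.size →
        Prog.foldOut (fun y =>
          (p.outO (fun _ => Val.nil) (Val.pair y.fst.fst.fst (Val.pair y.fst.snd y.snd))).map
            fun z => Val.pair y.fst.fst (if z.size ≤ y.fst.fst.snd.size then z else Val.nil))
          (l.map code) (Val.pair (Val.pair (code a.1) B) (code s)) =
        PMF.pure (Val.pair (Val.pair (code a.1) B) (code (l.foldl (f a.1) s))) := by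
      intro l
      induction l with
      | nil => intro s _; rfl
      | cons b l ih =>
        intro s hs
        have h1 := hC a.1 s b
        rw [code_cons, Val.size] at hs
        have h2 : (code (f a.1 s b)).size + C * (code l).size ≤ B.size := by
          linarith
        have h3 : (code (f a.1 s b)).size ≤ B.size := (Nat.le_add_right _ _).trans h2
        have h4 := hp' (a.1, s, b)
        simp only [code_prod] at h4
        simp only [List.map_cons, Prog.foldOut, Val.fst_pair, Val.snd_pair, h4, PMF.pure_map,
          PMF.pure_bind, h3, if_true, ih _ h2, List.foldl_cons]
    rw [key, PMF.pure_bind, Val.snd_pair]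
    refine le_trans ?_ hB'
    simp only [code_prod, Val.size]
    nlinarith
  exact h.comp (dpt_id.prodMk (hs.prodMk hl))

/-- Loops run over a single list, so the other list is part of the accumulator and loses its head in
each step. This head only moves within the accumulator, hence the growth constant 1 in `DPT.zip`. -/
theorem foldl_zip {β γ : Type} (l : List γ) (r : List β) (o : List (β × γ)) :
    (l.foldl (fun (s : List β × List (β × γ)) c =>
      (s.1.tail, s.1.head?.elim s.2 fun b => (b, c) :: s.2)) (r, o)).2.reverse =
      o.reverse ++ r.zip l := by
  induction l generalizing r o with
  | nil => simp
  | cons c l ih => cases r <;> simp [ih]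

@[fun_prop]
theorem DPT.zip {f : α → List β} {g : α → List γ} (hf : DPT f) (hg : DPT g) :
    DPT fun a => (f a).zip (g a) := by
  have hstep : DPT fun a : α × (List β × List (β × γ)) × γ =>
      (a.2.1.1.tail, a.2.1.1.head?.elim a.2.1.2 fun b => (b, a.2.2) :: a.2.1.2) := by
    fun_prop
  have h := DPT.foldl (f := fun (_ : α) (s : List β × List (β × γ)) c =>
    (s.1.tail, s.1.head?.elim s.2 fun b => (b, c) :: s.2)) (s := fun a => (f a, [])) hstep
    (by fun_prop) hg 1 (by
      rintro a ⟨r, o⟩ c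
      cases r with
      | nil => simp [code_prod, Val.size]
      | cons b r =>
        simp [code_prod, code_cons, Val.size]
        omega)
  have h' : DPT fun a => ((g a).foldl (fun (s : List β × List (β × γ)) c =>
      (s.1.tail, s.1.head?.elim s.2 fun b => (b, c) :: s.2)) (f a, [])).2.reverse := by
    fun_prop
  simpa only [foldl_zip, List.reverse_nil, List.nil_append] using h'

theorem code_bits_injective {l l' : List Bool} : code l = code l' ↔ l = l' := by
  induction l generalizing l' with
  | nil => cases l' <;> simp [code_nil, code_cons]
  | cons b l ih => cases l' <;> simp [code_nil, code_cons, code_bool, ih]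

-- Once all entries are overwritten with the same bit, equal lengths amount to equal codes.
@[fun_prop]
theorem DPT.decide_length_eq {f : α → List β} {g : α → List γ} (hf : DPT f) (hg : DPT g) :
    DPT fun a => decide ((f a).length = (g a).length) := by
  have h : DPT fun a => decide (code ((f a).map fun _ => true) = code ((g a).map fun _ => true)) :=
    by fun_prop
  simpa [code_bits_injective, List.map_const', List.replicate_right_injective] using h

theorem code_succ (n : ℕ) : code (n + 1) = Val.pair (Val.bit true) (code n) := rfl

@[fun_prop]
theorem dpt_succ : DPT fun n : ℕ => n + 1 :=
  DPT.of_prog (Prog.pair (Prog.const (Val.bit true)) Prog.id)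
    ((Prog.polyTime_const _).pair Prog.polyTime_id) fun n => by
      simp [Prog.out, Prog.outO_pair, Prog.outO_const, Prog.outO_id, code_succ]

/-- The last entry of a list with a given property. -/
def findLast {β : Type} (P : β → Bool) (l : List β) : Option β :=
  l.foldl (fun o b => bif P b then some b else o) none

theorem DPT.findLast {P : α → β → Bool} {l : α → List β}
    (hP : DPT fun a : α × β => P a.1 a.2) (hl : DPT l) : DPT fun a => findLast (P a) (l a) := by
  have hstep : DPT fun a : α × Option β × β =>
      bif P a.1 a.2.2 then Option.some a.2.2 else a.2.1 := by
    have : DPT fun a : α × Option β × β => P a.1 a.2.2 :=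
      hP.comp (f := fun a : α × Option β × β => (a.1, a.2.2)) (by fun_prop)
    fun_prop
  refine DPT.foldl (f := fun a o b => bif P a b then Option.some b else o) hstep (dpt_const _) hl 2 ?_
  intro a s b
  cases P a b
  · simp
  · simp [code_some, Val.size]
    omega

theorem findLast_spec {β : Type} (P : β → Bool) (l : List β) :
    (∃ b ∈ l, findLast P l = some b ∧ P b = true) ∨
      (findLast P l = none ∧ ∀ b ∈ l, P b = false) := by
  have key : ∀ (l : List β) (o : Option β),
      (∃ b ∈ l, l.foldl (fun o b => bif P b then some b else o) o = some b ∧ P b = true) ∨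
      (l.foldl (fun o b => bif P b then some b else o) o = o ∧ ∀ b ∈ l, P b = false) := by
    intro l
    induction l with
    | nil => simp
    | cons b l ih =>
      intro o
      rcases ih (bif P b then some b else o) with ⟨c, hc, h⟩ | ⟨h, h'⟩
      · exact Or.inl ⟨c, by simp [hc], h⟩
      · cases hb : P b with
        | true => exact Or.inl ⟨b, by simp, by simpa [hb] using h, hb⟩
        | false => exact Or.inr ⟨by simpa [hb] using h, by simpa [hb] using h'⟩
  exact key l none

/-- One step of the search for the first place where two bit strings differ. -/
def differStep {β : Type} (s : ℕ × Option β) (x : (Bool × Bool) × β) : ℕ × Option β :=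
  s.2.elim (bif (bif x.1.1 then !x.1.2 else x.1.2) then (s.1, some x.2) else (s.1 + 1, none))
    fun b => (s.1, some b)

/-- The first place where two bit strings differ, with the data attached to it. -/
def findDiffer {β : Type} (l : List ((Bool × Bool) × β)) : ℕ × Option β :=
  l.foldl differStep (0, none)

theorem DPT.findDiffer {l : α → List ((Bool × Bool) × β)} (hl : DPT l) :
    DPT fun a => findDiffer (l a) := by
  have hstep : DPT fun a : α × (ℕ × Option β) × (Bool × Bool) × β => differStep a.2.1 a.2.2 := by
    unfold differStep
    fun_prop
  refine DPT.foldl (f := fun _ s x => differStep s x) hstep (dpt_const _) hl 3 ?_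
  rintro a ⟨i, o⟩ ⟨⟨b, b'⟩, c⟩
  cases o <;> cases b <;> cases b' <;>
    simp [differStep, code_prod, code_none, code_some, code_succ, Val.size] <;> omega

theorem foldl_differStep_some {β : Type} (l : List ((Bool × Bool) × β)) (i : ℕ) (b : β) :
    l.foldl differStep (i, some b) = (i, some b) := by
  induction l with
  | nil => rfl
  | cons x l ih => simpa [differStep] using ih

theorem findDiffer_spec {β : Type} (l : List ((Bool × Bool) × β)) :
    (∃ i x, findDiffer l = (i, some x.2) ∧ l[i]? = some x ∧ x.1.1 ≠ x.1.2) ∨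
      ((findDiffer l).2 = none ∧ ∀ x ∈ l, x.1.1 = x.1.2) := by
  have key : ∀ (l : List ((Bool × Bool) × β)) (j : ℕ),
      (∃ i x, l.foldl differStep (j, none) = (j + i, some x.2) ∧ l[i]? = some x ∧
        x.1.1 ≠ x.1.2) ∨
      ((l.foldl differStep (j, none)).2 = none ∧ ∀ x ∈ l, x.1.1 = x.1.2) := by
    intro l
    induction l with
    | nil => simp
    | cons x l ih =>
      intro j
      by_cases hx : x.1.1 = x.1.2
      · have h : differStep (j, none) x = (j + 1, none) := by
          simp [differStep, hx]
        rw [List.foldl_cons, h]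
        rcases ih (j + 1) with ⟨i, y, h1, h2, h3⟩ | ⟨h1, h2⟩
        · exact Or.inl ⟨i + 1, y, by rw [h1, add_assoc, add_comm 1], by simpa using h2, h3⟩
        · exact Or.inr ⟨h1, by simpa [hx] using h2⟩
      · have h : differStep (j, none) x = (j, some x.2) := by
          obtain ⟨⟨b, b'⟩, c⟩ := x
          cases b <;> cases b' <;> simp_all [differStep]
        rw [List.foldl_cons, h, foldl_differStep_some]
        exact Or.inl ⟨0, x, rfl, rfl, hx⟩
  simpa [findDiffer] using key l 0

end

namespace Prog

/-! ### Executions with a list of the queries -/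

/-- The loop of `fold`, with the list of the queries made so far. -/
noncomputable def foldLog (step : List Val × Val → PMF (List Val × Val)) :
    List Val → List Val × Val → PMF (List Val × Val)
  | [], s => PMF.pure s
  | a :: l, s => (step (s.1, Val.pair s.2 a)).bind fun r => foldLog step l r

/-- The execution of a program with oracle `O` on an input, together with a list of queries made
earlier.  The queries of the program are added to the list. -/
noncomputable def runLog (O : Val → Val) : Prog → List Val × Val → PMF (List Val × Val)
  | id, s => PMF.pure s
  | const v, s => PMF.pure (s.1, v)
  | comp p q, s => (runLog O q s).bind fun r => runLog O p r
  | pair p q, s =>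
      (runLog O p s).bind fun r => (runLog O q (r.1, s.2)).bind fun t =>
        PMF.pure (t.1, Val.pair r.2 t.2)
  | fst, s => PMF.pure (s.1, s.2.fst)
  | snd, s => PMF.pure (s.1, s.2.snd)
  | eq, s => PMF.pure (s.1, Val.bit (decide (s.2.fst = s.2.snd)))
  | sizeLe, s => PMF.pure (s.1, Val.bit (decide (s.2.fst.size ≤ s.2.snd.size)))
  | ite c p q, s =>
      (runLog O c s).bind fun r =>
        if r.2 = Val.bit true then runLog O p (r.1, s.2) else runLog O q (r.1, s.2)
  | fold p, s => foldLog (fun y => runLog O p y) s.2.snd.toList (s.1, s.2.fst)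
  | coin, s => fairCoin.bind fun b => PMF.pure (s.1, Val.bit b)
  | query, s =>
      PMF.pure (s.2.fst :: s.1, if (O s.2.fst).size ≤ s.2.snd.size then O s.2.fst else Val.nil)

theorem runLog_map_snd (O : Val → Val) (p : Prog) (s : List Val × Val) :
    (runLog O p s).map Prod.snd = p.outO O s.2 := by
  have hb : ∀ {α : Type} (μ : PMF (List Val × Val)) (f : Val → PMF α),
      (μ.bind fun r => f r.2) = (μ.map Prod.snd).bind f := by
    intro α μ f
    rw [PMF.bind_map]
    rfl
  induction p generalizing s with
  | id => simp [runLog, outO_id, PMF.pure_map]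
  | const v => simp [runLog, outO_const, PMF.pure_map]
  | fst => simp [runLog, outO_fst, PMF.pure_map]
  | snd => simp [runLog, outO_snd, PMF.pure_map]
  | eq => simp [runLog, outO_eq, PMF.pure_map]
  | sizeLe => simp [runLog, outO_sizeLe, PMF.pure_map]
  | query => simp [runLog, outO_query, PMF.pure_map]
  | coin => simp [runLog, outO_coin, PMF.map, PMF.bind_bind, Function.comp_def]
  | comp p q ihp ihq =>
    simp only [runLog, PMF.map_bind, ihp, outO_comp, hb, ihq]
  | pair p q ihp ihq =>
    have h : ∀ r : List Val × Val, ((runLog O q (r.1, s.2)).bind fun t =>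
        PMF.pure (Val.pair r.2 t.2)) = (q.outO O s.2).bind fun z => PMF.pure (Val.pair r.2 z) := by
      intro r
      rw [hb (runLog O q (r.1, s.2)) fun z => PMF.pure (Val.pair r.2 z), ihq]
    simp only [runLog, PMF.map_bind, PMF.pure_map, h, outO_pair]
    rw [hb (runLog O p s) fun y => (q.outO O s.2).bind fun z => PMF.pure (Val.pair y z), ihp]
  | ite c p q ihc ihp ihq =>
    have h : ∀ r : List Val × Val, (if r.2 = Val.bit true then runLog O p (r.1, s.2)
        else runLog O q (r.1, s.2)).map Prod.snd =
          if r.2 = Val.bit true then p.outO O s.2 else q.outO O s.2 := by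
      intro r
      split_ifs
      · exact ihp _
      · exact ihq _
    simp only [runLog, PMF.map_bind, h, outO_ite]
    rw [hb (runLog O c s) fun y => if y = Val.bit true then p.outO O s.2 else q.outO O s.2, ihc]
  | fold p ih =>
    have key : ∀ (l : List Val) (s : List Val × Val),
        (foldLog (fun y => runLog O p y) l s).map Prod.snd =
          foldOut (fun y => p.outO O y) l s.2 := by
      intro l
      induction l with
      | nil => intro s; simp [foldLog, foldOut, PMF.pure_map]
      | cons a l ihl =>
        intro s
        simp only [foldLog, foldOut, PMF.map_bind, ihl]
        rw [hb (runLog O p (s.1, Val.pair s.2 a)) fun y => foldOut (fun y => p.outO O y) l y, ih]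
    rw [runLog, key, outO_fold]

/-! ### Simulation of the oracle -/

/-- Reads `((st, y), x)` as `(st, x)`. -/
def dropMiddle : Prog := pair (comp fst fst) snd

/-- On input `((c, log), x)`, runs a program on `x`, with each query `z` answered by `q (c, z)` and
added to the list `log`. -/
def simulate (q : Prog) : Prog → Prog
  | id => id
  | const v => pair fst (const v)
  | comp p r => comp (simulate q p) (simulate q r)
  | pair p r =>
      comp (pair (comp fst snd) (pair fst (comp snd snd)))
        (comp (pair (comp snd fst) (comp (simulate q r) dropMiddle)) (pair (simulate q p) snd))
  | fst => pair fst (comp fst snd)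
  | snd => pair fst (comp snd snd)
  | eq => pair fst (comp eq snd)
  | sizeLe => pair fst (comp sizeLe snd)
  | ite c p r =>
      comp (ite (comp snd fst) (comp (simulate q p) dropMiddle) (comp (simulate q r) dropMiddle))
        (pair (simulate q c) snd)
  | fold p =>
      comp (fold (comp (simulate q p) (pair (comp fst fst) (pair (comp snd fst) snd))))
        (pair (pair fst (comp fst snd)) (comp snd snd))
  | coin => pair fst coin
  | query =>
      pair (pair (comp fst fst) (pair (comp fst snd) (comp snd fst)))
        (comp (ite sizeLe fst (const Val.nil))
          (pair (comp q (pair (comp fst fst) (comp fst snd))) (comp snd snd)))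

/-- The pair of `c` and the log travels in front of every intermediate value and is threaded through
the constructs in the same order as the log of `runLog`. -/
theorem simulate_outO {O O' : Val → Val} {q : Prog} {c : Val}
    (hq : ∀ z, q.outO O (Val.pair c z) = PMF.pure (O' z)) (p : Prog) (log : List Val) (x : Val) :
    (simulate q p).outO O (Val.pair (Val.pair c (Val.ofList log)) x) =
      (runLog O' p (log, x)).map fun s => Val.pair (Val.pair c (Val.ofList s.1)) s.2 := by
  have hb : ∀ {α : Type} (μ : PMF (List Val × Val)) (f : Val → PMF α),
      (μ.map fun s => Val.pair (Val.pair c (Val.ofList s.1)) s.2).bind f =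
        μ.bind fun s => f (Val.pair (Val.pair c (Val.ofList s.1)) s.2) := by
    intro α μ f
    rw [PMF.bind_map]
    rfl
  induction p generalizing log x with
  | id => simp [simulate, runLog, outO_id, PMF.pure_map]
  | const v => simp [simulate, runLog, outO_pair, outO_fst, outO_const, PMF.pure_map]
  | fst | snd | eq | sizeLe =>
    simp [simulate, runLog, outO_pair, outO_comp, outO_fst, outO_snd, outO_eq, outO_sizeLe,
      PMF.pure_map]
  | query =>
    simp only [simulate, runLog, outO_pair, outO_comp, outO_fst, outO_snd, outO_sizeLe, outO_ite,
      outO_const, PMF.pure_bind, PMF.pure_map, Val.fst_pair, Val.snd_pair, hq, Val.ofList]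
    by_cases h : (O' x.fst).size ≤ x.snd.size <;> simp [h]
  | coin =>
    simp [simulate, runLog, outO_pair, outO_fst, outO_coin, PMF.map, PMF.bind_bind,
      Function.comp_def]
  | comp p r ihp ihr =>
    simp only [simulate, outO_comp, ihr, hb, ihp, runLog, PMF.map_bind]
  | pair p r ihp ihr =>
    simp only [simulate, dropMiddle, outO_comp, outO_pair, outO_fst, outO_snd, ihp, ihr, hb, runLog,
      PMF.map_bind, PMF.bind_bind, PMF.pure_bind, PMF.pure_map, Val.fst_pair, Val.snd_pair]
  | ite t p r iht ihp ihr =>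
    simp only [simulate, dropMiddle, outO_comp, outO_pair, outO_ite, outO_fst, outO_snd, iht, ihp,
      ihr, hb, runLog, PMF.map_bind, PMF.bind_bind, PMF.pure_bind, Val.fst_pair, Val.snd_pair]
    congr 1
    funext s
    split_ifs <;> rfl
  | fold p ih =>
    simp only [simulate, outO_comp, outO_pair, outO_fst, outO_snd, outO_fold, PMF.pure_bind,
      Val.fst_pair, Val.snd_pair, runLog]
    generalize x.snd.toList = l
    generalize x.fst = y
    induction l generalizing log y with
    | nil => simp [foldOut, foldLog, PMF.pure_map]
    | cons a l ihl =>
      simp only [foldOut, foldLog, Val.fst_pair, Val.snd_pair, ih, hb, PMF.map_bind, ihl]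

/-- The simulated run shadows a possible run of `p` with oracle `O'`, of cost `k`. The log grows by
at most `k`, because asking a query already costs more than its size. Each unit of the original cost
pays for handling values of size `O(L)` and for one answer of cost at most `M`. The constant `κ`
depends on the programs alone; the numerals in it are generous allowances for the bookkeeping. -/
theorem simulate_run (q p : Prog) :
    ∃ κ : ℕ, ∀ (O O' : Val → Val) (c : Val) (L M : ℕ),
      (∀ z, ∀ r ∈ (q.run O (Val.pair c z)).support, r.1 = O' z ∧ (z.size ≤ L → r.2 ≤ M)) →
      c.size ≤ L → ∀ log x, ∀ r ∈ ((simulate q p).run O (Val.pair (Val.pair c log) x)).support,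
      ∃ log' y k, r.1 = Val.pair (Val.pair c log') y ∧ (y, k) ∈ (p.run O' x).support ∧
        log'.size ≤ log.size + k ∧ (log.size + k ≤ L → r.2 ≤ κ * k * (L + M + 1)) := by
  have hk : ∀ {k W n κ : ℕ}, 1 ≤ k → n ≤ κ * W → n ≤ κ * k * W := by
    intro k W n κ h1 h2
    calc n ≤ κ * 1 * W := by simpa using h2
      _ ≤ κ * k * W := by gcongr
  -- Adds the costs of two subprograms and of the bookkeeping; the `1` in `1 + k₁ + k₂ ≤ k`, the
  -- construct's own cost, pays for the bookkeeping.
  have hadd : ∀ {k k₁ k₂ m₁ m₂ n κ₁ κ₂ W : ℕ} (κ₃ : ℕ), m₁ ≤ κ₁ * k₁ * W → m₂ ≤ κ₂ * k₂ * W →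
      n ≤ κ₃ * W → 1 + k₁ + k₂ ≤ k → n + m₁ + m₂ ≤ (κ₁ + κ₂ + κ₃) * k * W := by
    intro k k₁ k₂ m₁ m₂ n κ₁ κ₂ W κ₃ h1 h2 h3 h4
    calc n + m₁ + m₂ ≤ κ₃ * 1 * W + κ₁ * k₁ * W + κ₂ * k₂ * W := by
          rw [mul_one]
          gcongr
      _ ≤ κ₃ * k * W + κ₁ * k * W + κ₂ * k * W := by
          gcongr <;> omega
      _ = (κ₁ + κ₂ + κ₃) * k * W := by ring
  induction p with
  | id | const v | fst | snd | eq | sizeLe =>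
    refine ⟨100, fun O O' c L M hq hc log x r hr => ?_⟩
    simp only [simulate, run, PMF.pure_bind, PMF.support_pure, Set.mem_singleton_iff, Val.fst_pair,
      Val.snd_pair] at hr
    subst hr
    refine ⟨log, _, _, rfl, (PMF.mem_support_pure_iff _ _).2 rfl, by omega, fun h => ?_⟩
    refine hk (by omega) ?_
    simp only [Val.size]
    omega
  | coin =>
    refine ⟨100, fun O O' c L M hq hc log x r hr => ?_⟩
    simp only [simulate, run, PMF.pure_bind, PMF.bind_bind, PMF.mem_support_bind_iff,
      PMF.support_pure, Set.mem_singleton_iff, Val.fst_pair] at hr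
    obtain ⟨b, hb, rfl⟩ := hr
    refine ⟨log, Val.bit b, 1 + x.size, rfl, ?_, by omega, fun h => ?_⟩
    · simp only [run, PMF.mem_support_bind_iff, PMF.support_pure, Set.mem_singleton_iff]
      exact ⟨b, hb, rfl⟩
    · refine hk (by omega) ?_
      simp only [Val.size]
      omega
  | query =>
    refine ⟨200, fun O O' c L M hq hc log x r hr => ?_⟩
    simp only [simulate, run, PMF.pure_bind, PMF.bind_bind, PMF.mem_support_bind_iff,
      Val.fst_pair, Val.snd_pair] at hr
    obtain ⟨s, hs, hr⟩ := hr
    obtain ⟨h1, h2⟩ := hq _ s hs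
    have h3 := size_le_cost O q _ hs
    have h4 := x.fst_size_le
    have h5 := x.snd_size_le
    have hr' : r.1 = Val.pair (Val.pair c (Val.pair x.fst log))
        (if (O' x.fst).size ≤ x.snd.size then O' x.fst else Val.nil) ∧
        (log.size + (1 + x.size) ≤ L → r.2 ≤ 200 * (L + M + 1)) := by
      rw [h1] at hr h3
      by_cases h : (O' x.fst).size ≤ x.snd.size
      all_goals
        simp only [h, decide_true, decide_false, if_true, if_false, Val.bit.injEq,
          Bool.false_eq_true, PMF.support_pure, Set.mem_singleton_iff, Val.size] at hr h3 ⊢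
        obtain ⟨_, rfl, rfl⟩ := hr
        refine ⟨rfl, fun hL => ?_⟩
        have h6 := h2 (by omega)
        dsimp only
        omega
    refine ⟨_, _, 1 + x.size, hr'.1, ?_, ?_, fun h => hk (by omega) (hr'.2 h)⟩
    · simp [run]
    · simp only [Val.size]
      omega
  | comp p r ihp ihr =>
    obtain ⟨κ₁, ihp⟩ := ihp
    obtain ⟨κ₂, ihr⟩ := ihr
    refine ⟨κ₁ + κ₂ + 100, fun O O' c L M hq hc log x t ht => ?_⟩
    simp only [simulate, run, PMF.mem_support_bind_iff, PMF.support_pure,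
      Set.mem_singleton_iff] at ht
    obtain ⟨⟨_, m⟩, hs, ⟨_, m'⟩, ht, rfl⟩ := ht
    obtain ⟨log₁, y₁, k₁, rfl, a2, a3, a4⟩ := ihr O O' c L M hq hc log x _ hs
    obtain ⟨log₂, y₂, k₂, rfl, b2, b3, b4⟩ := ihp O O' c L M hq hc log₁ y₁ _ ht
    refine ⟨log₂, y₂, 1 + x.size + k₁ + k₂, rfl, ?_, by omega, fun h => ?_⟩
    · simp only [run, PMF.mem_support_bind_iff, PMF.support_pure, Set.mem_singleton_iff]
      exact ⟨_, a2, _, b2, rfl⟩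
    · refine le_trans (le_of_eq ?_) (hadd 100 (b4 (by omega)) (a4 (by omega))
        (n := 1 + (Val.pair (Val.pair c log) x).size) ?_ ?_)
      · ring
      · simp only [Val.size]
        omega
      · omega
  | pair p r ihp ihr =>
    obtain ⟨κ₁, ihp⟩ := ihp
    obtain ⟨κ₂, ihr⟩ := ihr
    refine ⟨κ₁ + κ₂ + 200, fun O O' c L M hq hc log x t ht => ?_⟩
    simp only [simulate, dropMiddle, run, PMF.mem_support_bind_iff, PMF.support_pure,
      Set.mem_singleton_iff, PMF.bind_bind, PMF.pure_bind, Val.fst_pair, Val.snd_pair] at ht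
    obtain ⟨⟨_, m⟩, hs, ht⟩ := ht
    obtain ⟨log₁, y₁, k₁, rfl, a2, a3, a4⟩ := ihp O O' c L M hq hc log x _ hs
    simp only [Val.fst_pair, Val.snd_pair] at ht
    obtain ⟨⟨_, m'⟩, hs', rfl⟩ := ht
    obtain ⟨log₂, y₂, k₂, rfl, b2, b3, b4⟩ := ihr O O' c L M hq hc log₁ x _ hs'
    have h1 := size_le_cost _ _ _ a2
    have h2 := size_le_cost _ _ _ b2
    dsimp only at h1 h2 a4 b4
    refine ⟨log₂, Val.pair y₁ y₂, 1 + x.size + k₁ + k₂, rfl, ?_, by omega, fun h => ?_⟩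
    · simp only [run, PMF.mem_support_bind_iff, PMF.support_pure, Set.mem_singleton_iff]
      exact ⟨_, a2, _, b2, rfl⟩
    · have h3 := hadd (n := 200 * (L + M + 1)) 200 (a4 (by omega)) (b4 (by omega)) le_rfl
        (k := 1 + x.size + k₁ + k₂) (by omega)
      refine le_trans ?_ h3
      simp only [Val.size]
      omega
  | ite t p r iht ihp ihr =>
    obtain ⟨κ₁, iht⟩ := iht
    obtain ⟨κ₂, ihp⟩ := ihp
    obtain ⟨κ₃, ihr⟩ := ihr
    refine ⟨κ₁ + (κ₂ + κ₃) + 200, fun O O' c L M hq hc log x u hu => ?_⟩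
    simp only [simulate, dropMiddle, run, PMF.mem_support_bind_iff, PMF.support_pure,
      Set.mem_singleton_iff, PMF.bind_bind, PMF.pure_bind, Val.fst_pair, Val.snd_pair] at hu
    obtain ⟨⟨_, m⟩, hs, u', hu, rfl⟩ := hu
    obtain ⟨log₁, y₁, k₁, rfl, a2, a3, a4⟩ := iht O O' c L M hq hc log x _ hs
    simp only [Val.fst_pair, Val.snd_pair] at hu
    have h1 := size_le_cost _ _ _ a2
    dsimp only at h1 a4
    have hu' : ∃ log₂ y₂ k₂, u'.1 = Val.pair (Val.pair c log₂) y₂ ∧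
        (y₂, k₂) ∈ (if y₁ = Val.bit true then run O' p x else run O' r x).support ∧
        log₂.size ≤ log₁.size + k₂ ∧ x.size + 1 ≤ k₂ ∧
        (log₁.size + k₂ ≤ L → u'.2 ≤ 20 * (Val.pair (Val.pair (Val.pair c log₁) y₁) x).size + 20 +
          (κ₂ + κ₃) * k₂ * (L + M + 1)) := by
      by_cases h : y₁ = Val.bit true
      all_goals
        simp only [h, if_true, if_false] at hu ⊢
        simp only [PMF.mem_support_bind_iff, PMF.support_pure, Set.mem_singleton_iff] at hu
        obtain ⟨⟨_, m'⟩, hs', rfl⟩ := hu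
      · obtain ⟨log₂, y₂, k₂, rfl, b2, b3, b4⟩ := ihp O O' c L M hq hc log₁ x _ hs'
        refine ⟨log₂, y₂, k₂, rfl, b2, b3, (size_le_cost _ _ _ b2).2, fun hL => ?_⟩
        have b5 := b4 hL
        have b6 : κ₂ * k₂ * (L + M + 1) ≤ (κ₂ + κ₃) * k₂ * (L + M + 1) := by gcongr; omega
        simp only [Val.size] at b5 ⊢
        omega
      · obtain ⟨log₂, y₂, k₂, rfl, b2, b3, b4⟩ := ihr O O' c L M hq hc log₁ x _ hs'
        refine ⟨log₂, y₂, k₂, rfl, b2, b3, (size_le_cost _ _ _ b2).2, fun hL => ?_⟩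
        have b5 := b4 hL
        have b6 : κ₃ * k₂ * (L + M + 1) ≤ (κ₂ + κ₃) * k₂ * (L + M + 1) := by gcongr; omega
        simp only [Val.size] at b5 ⊢
        omega
    obtain ⟨log₂, y₂, k₂, h2, b2, b3, b4, b5⟩ := hu'
    refine ⟨log₂, y₂, 1 + x.size + k₁ + k₂, h2, ?_, by omega, fun h => ?_⟩
    · simp only [run, PMF.mem_support_bind_iff, PMF.support_pure, Set.mem_singleton_iff]
      exact ⟨_, a2, _, b2, rfl⟩
    · have h3 := hadd (n := 200 * (L + M + 1)) 200 (a4 (by omega)) le_rfl le_rfl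
        (k := 1 + x.size + k₁ + k₂) (k₂ := k₂) (κ₂ := κ₂ + κ₃) (by omega)
      refine le_trans ?_ h3
      have h4 := b5 (by omega)
      simp only [Val.size] at h4 ⊢
      omega
  | fold p ih =>
    obtain ⟨κ, ih⟩ := ih
    refine ⟨κ + 300, fun O O' c L M hq hc log x t ht => ?_⟩
    simp only [simulate, run, PMF.mem_support_bind_iff, PMF.support_pure,
      Set.mem_singleton_iff, PMF.bind_bind, PMF.pure_bind, Val.fst_pair, Val.snd_pair] at ht
    obtain ⟨s, hs, rfl⟩ := ht
    -- The step is the translated loop body with its overhead written out. Every iteration of the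
    -- original loop costs at least 1, so the extra `100` in the constant absorbs that overhead.
    have key : ∀ (l : List Val) (log y : Val),
        ∀ s ∈ (foldRun (fun v => (run O (simulate q p)
          (Val.pair v.fst.fst (Val.pair v.fst.snd v.snd))).bind fun s =>
            PMF.pure (s.1, 1 + v.size + (1 + v.size + (1 + v.size + (1 + v.size) +
              (1 + v.fst.size)) + (1 + v.size + (1 + v.size + (1 + v.size) + (1 + v.fst.size)) +
              (1 + v.size))) + s.2)) l (Val.pair (Val.pair c log) y)).support,
        ∃ log' y' k, s.1 = Val.pair (Val.pair c log') y' ∧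
          (y', k) ∈ (foldRun (fun v => run O' p v) l y).support ∧
          log'.size ≤ log.size + k ∧ (log.size + k ≤ L → s.2 ≤ (κ + 100) * k * (L + M + 1)) := by
      intro l
      induction l with
      | nil =>
        intro log y s hs
        simp only [foldRun, PMF.support_pure, Set.mem_singleton_iff] at hs
        subst hs
        exact ⟨log, y, 0, rfl, by simp [foldRun], by simp, by simp⟩
      | cons a l ihl =>
        intro log y s hs
        simp only [foldRun, PMF.mem_support_bind_iff, PMF.support_pure, Set.mem_singleton_iff,
          PMF.bind_bind, PMF.pure_bind, Val.fst_pair, Val.snd_pair] at hs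
        obtain ⟨⟨_, m⟩, hs, ⟨_, m'⟩, hs', rfl⟩ := hs
        obtain ⟨log₁, y₁, k₁, rfl, a2, a3, a4⟩ := ih O O' c L M hq hc log _ _ hs
        obtain ⟨log₂, y₂, k₂, rfl, b2, b3, b4⟩ := ihl _ _ _ hs'
        have h1 := size_le_cost _ _ _ a2
        dsimp only [Val.size] at h1 a4 b4
        refine ⟨log₂, y₂, k₁ + k₂, rfl, ?_, by omega, fun h => ?_⟩
        · simp only [foldRun, PMF.mem_support_bind_iff, PMF.support_pure, Set.mem_singleton_iff]
          exact ⟨_, a2, _, b2, rfl⟩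
        · have h2 := a4 (by omega)
          have h3 := b4 (by omega)
          have h4 : 100 * (L + M + 1) ≤ 100 * k₁ * (L + M + 1) := by
            gcongr
            omega
          have h5 : (κ + 100) * (k₁ + k₂) * (L + M + 1) =
              κ * k₁ * (L + M + 1) + 100 * k₁ * (L + M + 1) + (κ + 100) * k₂ * (L + M + 1) := by
            ring
          rw [h5]
          simp only [Val.size]
          omega
    obtain ⟨log', y', k, h1, h2, h3, h4⟩ := key _ _ _ _ hs
    have h6 := x.fst_size_le
    have h7 := x.snd_size_le
    refine ⟨log', y', 1 + x.size + k, h1, ?_, by omega, fun h => ?_⟩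
    · simp only [run, PMF.mem_support_bind_iff, PMF.support_pure, Set.mem_singleton_iff]
      exact ⟨_, h2, rfl⟩
    · have h5 := hadd (n := 200 * (L + M + 1)) (m₁ := 0) (k₁ := 0) (κ₁ := 0) 200 (by simp)
        (h4 (by omega)) le_rfl (k := 1 + x.size + k) (by omega)
      refine le_trans ?_ (h5.trans (le_of_eq (by ring)))
      simp only [Val.size]
      omega

end Prog

/-! ### Comparison of probabilities in two games. -/

section

variable {α β : Type}

theorem PMF.bind_apply_congr_support {μ : PMF α} {f g : α → PMF β} {b : β}
    (h : ∀ a ∈ μ.support, f a b = g a b) : μ.bind f b = μ.bind g b := by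
  rw [PMF.bind_apply, PMF.bind_apply]
  refine tsum_congr fun a => ?_
  by_cases ha : μ a = 0
  · simp [ha]
  · rw [h a ((PMF.mem_support_iff _ _).2 ha)]

theorem PMF.bind_congr_support {μ : PMF α} {f g : α → PMF β} (h : ∀ a ∈ μ.support, f a = g a) :
    μ.bind f = μ.bind g :=
  PMF.ext fun _ => PMF.bind_apply_congr_support fun a ha => by rw [h a ha]

/-- The second alternative allows `μ` and `ν` to differ at samples from which `b` cannot be reached;
these will be the states with a bad query. -/
theorem PMF.bind_apply_congr {μ ν : PMF α} {f g : α → PMF β} {b : β}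
    (h : ∀ a, (μ a = ν a ∧ f a b = g a b) ∨ (f a b = 0 ∧ g a b = 0)) :
    μ.bind f b = ν.bind g b := by
  rw [PMF.bind_apply, PMF.bind_apply]
  refine tsum_congr fun a => ?_
  rcases h a with ⟨h1, h2⟩ | ⟨h1, h2⟩
  · rw [h1, h2]
  · rw [h1, h2, mul_zero, mul_zero]

theorem PMF.bind_apply_mono {γ : Type} {μ : PMF α} {f : α → PMF β} {g : α → PMF γ} {b : β} {c : γ}
    (h : ∀ a ∈ μ.support, f a b ≤ g a c) : μ.bind f b ≤ μ.bind g c := by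
  rw [PMF.bind_apply, PMF.bind_apply]
  refine ENNReal.tsum_le_tsum fun a => ?_
  by_cases ha : μ a = 0
  · simp [ha]
  · gcongr
    exact h a ((PMF.mem_support_iff _ _).2 ha)

/-- Two games with the same probabilities of ending without a bad event differ by at most the
probability of the bad event. -/
theorem PMF.abs_sub_le_of_bad {μ ν : PMF (Bool × Bool)} (h : ∀ w, μ (w, false) = ν (w, false)) :
    |((μ.map Prod.fst) true).toReal - ((ν.map Prod.fst) true).toReal| ≤
      ((ν.map Prod.snd) true).toReal := by
  have hfst : ∀ μ : PMF (Bool × Bool), ((μ.map Prod.fst) true).toReal =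
      (μ (true, true)).toReal + (μ (true, false)).toReal := by
    intro μ
    rw [PMF.map_apply, tsum_fintype, ← ENNReal.toReal_add (μ.apply_ne_top _) (μ.apply_ne_top _)]
    simp [Fintype.sum_prod_type]
  have hsnd : ∀ μ : PMF (Bool × Bool), ((μ.map Prod.snd) true).toReal =
      (μ (true, true)).toReal + (μ (false, true)).toReal := by
    intro μ
    rw [PMF.map_apply, tsum_fintype, ← ENNReal.toReal_add (μ.apply_ne_top _) (μ.apply_ne_top _)]
    simp [Fintype.sum_prod_type]
  have hsum : ∀ μ : PMF (Bool × Bool), (μ (true, true)).toReal + (μ (true, false)).toReal +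
      (μ (false, true)).toReal + (μ (false, false)).toReal = 1 := by
    intro μ
    have h1 := μ.tsum_coe
    rw [tsum_fintype] at h1
    have h2 := congrArg ENNReal.toReal h1
    rw [ENNReal.toReal_sum fun a _ => μ.apply_ne_top a] at h2
    simpa [Fintype.sum_prod_type, add_assoc] using h2
  rw [hfst, hfst, hsnd, h true]
  -- Both total masses are 1 and the good parts agree, so the bad parts have the same mass; it
  -- bounds the difference.
  have h1 := hsum μ
  have h2 := hsum ν
  rw [h true, h false] at h1
  have := ENNReal.toReal_nonneg (a := μ (true, true))
  have := ENNReal.toReal_nonneg (a := ν (true, true))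
  have := ENNReal.toReal_nonneg (a := μ (false, true))
  have := ENNReal.toReal_nonneg (a := ν (false, true))
  rw [abs_le]
  constructor <;> linarith

end

/-! ### Runs without bad queries. -/

namespace Prog

theorem foldLog_subset {step : List Val × Val → PMF (List Val × Val)}
    (h : ∀ s, ∀ t ∈ (step s).support, s.1 ⊆ t.1) (l : List Val) (s : List Val × Val) :
    ∀ t ∈ (foldLog step l s).support, s.1 ⊆ t.1 := by
  induction l generalizing s with
  | nil =>
    intro t ht
    simp only [foldLog, PMF.support_pure, Set.mem_singleton_iff] at ht
    simp [ht]
  | cons a l ih =>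
    intro t ht
    simp only [foldLog, PMF.mem_support_bind_iff] at ht
    obtain ⟨r, hr, ht⟩ := ht
    exact List.Subset.trans (h (s.1, Val.pair s.2 a) r hr) (ih _ t ht)

/-- Queries are never removed from the log, so a final log without bad queries excludes them at
every earlier moment. -/
theorem runLog_subset (O : Val → Val) (p : Prog) (s : List Val × Val) :
    ∀ t ∈ (runLog O p s).support, s.1 ⊆ t.1 := by
  induction p generalizing s with
  | id | const | fst | snd | eq | sizeLe | query =>
    intro t ht
    simp only [runLog, PMF.support_pure, Set.mem_singleton_iff] at ht
    simp [ht]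
  | coin =>
    intro t ht
    simp only [runLog, PMF.mem_support_bind_iff, PMF.support_pure, Set.mem_singleton_iff] at ht
    obtain ⟨b, -, rfl⟩ := ht
    simp
  | comp p q ihp ihq =>
    intro t ht
    simp only [runLog, PMF.mem_support_bind_iff] at ht
    obtain ⟨r, hr, ht⟩ := ht
    exact List.Subset.trans (ihq _ r hr) (ihp _ t ht)
  | pair p q ihp ihq =>
    intro t ht
    simp only [runLog, PMF.mem_support_bind_iff, PMF.support_pure, Set.mem_singleton_iff] at ht
    obtain ⟨r, hr, u, hu, rfl⟩ := ht
    exact List.Subset.trans (ihp _ r hr) (ihq (r.1, s.2) u hu)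
  | ite c p q ihc ihp ihq =>
    intro t ht
    simp only [runLog, PMF.mem_support_bind_iff] at ht
    obtain ⟨r, hr, ht⟩ := ht
    refine List.Subset.trans (ihc _ r hr) ?_
    split_ifs at ht
    · exact ihp (r.1, s.2) t ht
    · exact ihq (r.1, s.2) t ht
  | fold p ih => exact foldLog_subset ih _ _

/-- Two oracles that agree except on bad queries lead with the same probability to the same outcome
without bad queries. -/
theorem runLog_congr {O O' : Val → Val} {bad : Val → Prop} (h : ∀ z, ¬ bad z → O z = O' z)
    (p : Prog) (s t : List Val × Val) (ht : ∀ z ∈ t.1, ¬ bad z) :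
    runLog O p s t = runLog O' p s t := by
  -- Intermediate states whose log contains a bad query contribute zero on both sides, because they
  -- cannot lead to `t`.
  have hbind : ∀ {μ ν : PMF (List Val × Val)} {f g : List Val × Val → PMF (List Val × Val)}
      {t : List Val × Val}, (∀ z ∈ t.1, ¬ bad z) →
      (∀ r, (∀ z ∈ r.1, ¬ bad z) → μ r = ν r) → (∀ r, (∀ z ∈ r.1, ¬ bad z) → f r t = g r t) →
      (∀ r, t ∈ (f r).support → r.1 ⊆ t.1) → (∀ r, t ∈ (g r).support → r.1 ⊆ t.1) →
      μ.bind f t = ν.bind g t := by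
    intro μ ν f g t ht hμ hf hf' hg'
    refine PMF.bind_apply_congr fun r => ?_
    by_cases hr : ∀ z ∈ r.1, ¬ bad z
    · exact Or.inl ⟨hμ r hr, hf r hr⟩
    · refine Or.inr ⟨?_, ?_⟩
      · by_contra hne
        exact hr fun z hz => ht z (hf' r ((PMF.mem_support_iff _ _).2 hne) hz)
      · by_contra hne
        exact hr fun z hz => ht z (hg' r ((PMF.mem_support_iff _ _).2 hne) hz)
  induction p generalizing s t with
  | id | const | fst | snd | eq | sizeLe | coin => rfl
  | query =>
    simp only [runLog]
    by_cases hs : bad s.2.fst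
    -- A bad query would be on the log of the outcome, whatever the answer: both probabilities
    -- vanish.
    · have hne : ∀ y, t ≠ (s.2.fst :: s.1, y) := by
        rintro y rfl
        exact ht s.2.fst (by simp) hs
      rw [PMF.pure_apply, PMF.pure_apply, if_neg (hne _), if_neg (hne _)]
    · rw [h _ hs]
  | comp p q ihp ihq =>
    exact hbind ht (fun r hr => ihq s r hr) (fun r _ => ihp r t ht)
      (fun r hr => runLog_subset _ _ _ _ hr) (fun r hr => runLog_subset _ _ _ _ hr)
  | pair p q ihp ihq =>
    have hsub : ∀ (O : Val → Val) (r : List Val × Val),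
        t ∈ ((runLog O q (r.1, s.2)).bind fun u => PMF.pure (u.1, Val.pair r.2 u.2)).support →
          r.1 ⊆ t.1 := by
      intro O r hr
      simp only [PMF.mem_support_bind_iff, PMF.support_pure, Set.mem_singleton_iff] at hr
      obtain ⟨u, hu, rfl⟩ := hr
      exact runLog_subset _ _ (r.1, s.2) u hu
    refine hbind ht (fun r hr => ihp s r hr) (fun r _ => ?_) (hsub O) (hsub O')
    refine hbind ht (fun u hu => ihq _ u hu) (fun _ _ => rfl) (fun u hu => ?_) (fun u hu => ?_)
    all_goals
      simp only [PMF.support_pure, Set.mem_singleton_iff] at hu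
      simp [hu]
  | ite c p q ihc ihp ihq =>
    have hsub : ∀ (O : Val → Val) (r : List Val × Val),
        t ∈ (if r.2 = Val.bit true then runLog O p (r.1, s.2)
          else runLog O q (r.1, s.2)).support → r.1 ⊆ t.1 := by
      intro O r hr
      split_ifs at hr
      · exact runLog_subset _ _ (r.1, s.2) t hr
      · exact runLog_subset _ _ (r.1, s.2) t hr
    refine hbind ht (fun r hr => ihc s r hr) (fun r _ => ?_) (hsub O) (hsub O')
    split_ifs
    · exact ihp _ t ht
    · exact ihq _ t ht
  | fold p ih =>
    simp only [runLog]
    generalize s.2.snd.toList = l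
    generalize (s.1, s.2.fst) = s
    induction l generalizing s with
    | nil => rfl
    | cons a l ihl =>
      exact hbind ht (fun r hr => ih _ r hr) (fun r _ => ihl r)
        (fun r hr => foldLog_subset (runLog_subset _ _) _ _ _ hr)
        (fun r hr => foldLog_subset (runLog_subset _ _) _ _ _ hr)

end Prog

/-- A polynomial-time program can be executed, and its queries be listed, in probabilistic
polynomial time, if the answers of its oracle are computed in polynomial time. -/
theorem PPT.runLog {α : Type} [Coded α] {A : Prog} (hA : A.PolyTime) {ans : α → Val → Val}
    (hans : DPT fun a : α × Val => ans a.1 a.2) :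
    PPT fun a : α × Val => A.runLog (ans a.1) ([], a.2) := by
  obtain ⟨q, hq, hq'⟩ := hans
  simp only [Prog.out, PMF.pure_map] at hq'
  -- The cost of `A` is bounded only for oracles that are functions. With an arbitrary outer oracle
  -- `O`, the program `q` might answer the same query in two ways; derandomized, it computes the
  -- function `q.value O`, and the bound for `A` applies.
  obtain ⟨κ, hκ⟩ := Prog.simulate_run q.derandomize A
  have hpoly : (Prog.comp (Prog.simulate q.derandomize A)
      (Prog.pair (Prog.pair Prog.fst (Prog.const Val.nil)) Prog.snd)).PolyTime := by
    obtain ⟨P, hP⟩ := hA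
    obtain ⟨Q, hQ⟩ := hq.derandomize
    -- `L = 1 + x.size + P.eval x.size` covers the context and the log throughout the run. A query
    -- of size at most `L`, paired with the context, has size at most `2 * L + 1`, which gives `M =
    -- Q.eval (2 * L + 1)`.
    refine ⟨100 * (1 + Polynomial.X) + Polynomial.C κ * P * (1 + Polynomial.X + P +
      Q.comp (2 * (1 + Polynomial.X + P) + 1) + 1), fun O x r hr => ?_⟩
    simp only [Prog.run, PMF.mem_support_bind_iff, PMF.support_pure, Set.mem_singleton_iff,
      PMF.pure_bind] at hr
    obtain ⟨s, hs, rfl⟩ := hr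
    have hx := x.fst_size_le
    have hx' := x.snd_size_le
    obtain ⟨log, y, m, -, h2, -, h4⟩ := hκ O (fun z => q.value O (Val.pair x.fst z)) x.fst
      (1 + x.size + P.eval x.size) (Q.eval (2 * (1 + x.size + P.eval x.size) + 1))
      (fun z r hr => ⟨Prog.derandomize_run_support hr, fun hz => (hQ O _ r hr).trans
        (Q.eval_nat_mono (by simp only [Val.size]; omega))⟩) (by omega) Val.nil x.snd s hs
    have h5 := (hP _ _ _ h2).trans (P.eval_nat_mono hx')
    have h6 := h4 (by simp only [Val.size]; omega)
    have h7 : κ * m * (1 + x.size + P.eval x.size +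
        Q.eval (2 * (1 + x.size + P.eval x.size) + 1) + 1) ≤ κ * P.eval x.size *
        (1 + x.size + P.eval x.size + Q.eval (2 * (1 + x.size + P.eval x.size) + 1) + 1) := by
      gcongr
    simp [Polynomial.eval_comp, Val.size]
    omega
  refine ⟨Prog.comp (Prog.pair (Prog.comp Prog.snd Prog.fst) Prog.snd) _,
    ((Prog.polyTime_snd.comp Prog.polyTime_fst).pair Prog.polyTime_snd).comp hpoly, fun a => ?_⟩
  have hans : ∀ z, q.derandomize.outO (fun _ => Val.nil) (Val.pair (code a.1) z) =
      PMF.pure (ans a.1 z) := fun z => by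
    rw [Prog.derandomize_outO]
    exact congrArg PMF.pure (Prog.value_eq_of_outO_eq_pure (hq' (a.1, z)))
  have h := Prog.simulate_outO hans A [] a.2
  simp only [Val.ofList] at h
  simp only [Prog.out, Prog.outO_comp, Prog.outO_pair, Prog.outO_fst, Prog.outO_snd,
    Prog.outO_const, PMF.pure_bind, code_prod, Val.fst_pair, Val.snd_pair]
  rw [show code a.2 = a.2 from rfl, h, PMF.bind_map]
  simp [PMF.map, Function.comp_def, code_prod, code_list_val, code_val]

/-! ### The algorithms of the schemes -/

theorem code_option_val (o : Option Val) : code o = Val.ofOption o := by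
  cases o <;> rfl

@[fun_prop]
theorem dpt_ofList : DPT Val.ofList :=
  DPT.of_prog Prog.id Prog.polyTime_id fun l => by
    rw [Prog.out, Prog.outO_id, code_list_val]
    rfl

@[fun_prop]
theorem dpt_ofBits : DPT Val.ofBits :=
  DPT.of_prog Prog.id Prog.polyTime_id fun _ => Prog.outO_id _ _

@[fun_prop]
theorem dpt_ofOption : DPT Val.ofOption :=
  DPT.of_prog Prog.id Prog.polyTime_id fun o => by
    rw [Prog.out, Prog.outO_id, code_option_val]
    rfl

@[fun_prop]
theorem dpt_toBits : DPT Val.toBits := by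
  unfold Val.toBits
  fun_prop

@[fun_prop]
theorem dpt_derivedKey : DPT fun a : Val × List Bool => derivedKey a.1 a.2 := by
  have h : (fun a : Val × List Bool => derivedKey a.1 a.2) = fun a =>
      Val.ofList ((a.1.toList.zip a.2).map fun x => bif x.2 then x.1.snd else x.1.fst) := by
    funext a
    simp only [derivedKey, List.zip, List.map_zipWith, cond_eq_ite]
  rw [h]
  fun_prop

theorem IsPPT.ppt {α : Type} [Coded α] {f : α → PMF Val} (h : IsPPT code f) : PPT f := by
  obtain ⟨p, hp, hp'⟩ := h
  exact ⟨p, hp, fun a => by rw [hp']; exact (PMF.map_id _).symm⟩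

theorem PKE.Efficient.ppt_gen {S : PKE} (h : S.Efficient) : PPT S.gen := h.gen

theorem PKE.Efficient.ppt_enc {S : PKE} (h : S.Efficient) :
    PPT fun a : ℕ × Val × Val => S.enc a.1 a.2.1 a.2.2 := IsPPT.ppt h.enc

theorem PKE.Efficient.dpt_dec {S : PKE} (h : S.Efficient) :
    DPT fun a : ℕ × Val × Val => S.dec a.1 a.2.1 a.2.2 := by
  obtain ⟨p, hp, hp'⟩ := h.dec
  exact DPT.of_prog p hp fun a => by rw [code_option_val]; exact hp' a

theorem SignatureScheme.Efficient.ppt_gen {SS : SignatureScheme} (h : SS.Efficient) :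
    PPT SS.gen := h.gen

theorem SignatureScheme.Efficient.ppt_sign {SS : SignatureScheme} (h : SS.Efficient) :
    PPT fun a : ℕ × Val × Val => SS.sign a.1 a.2.1 a.2.2 := IsPPT.ppt h.sign

theorem SignatureScheme.Efficient.dpt_ver {SS : SignatureScheme} (h : SS.Efficient) :
    DPT fun a : ℕ × List Bool × Val × Val => SS.ver a.1 a.2.1 a.2.2.1 a.2.2.2 := by
  obtain ⟨p, hp, hp'⟩ := h.ver
  exact DPT.of_prog p hp hp'

theorem RandomizedEncoding.Efficient.ppt_encode {E : RandomizedEncoding} (h : E.Efficient) :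
    PPT fun a : ℕ × Val => E.encode a.1 a.2 := IsPPT.ppt h.encode

theorem RandomizedEncoding.Efficient.dpt_decode {E : RandomizedEncoding} (h : E.Efficient) :
    DPT fun a : ℕ × Val => E.decode a.1 a.2 := by
  obtain ⟨p, hp, hp'⟩ := h.decode
  exact DPT.of_prog p hp fun a => by rw [code_option_val]; exact hp' a

theorem ppt_repetition_enc {S : PKE} {E : RandomizedEncoding} (k : ℕ → ℕ) (hS : S.Efficient)
    (hE : E.Efficient) :
    PPT fun a : ℕ × Val × Val => (S.repetition E k).enc a.1 a.2.1 a.2.2 := by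
  have h1 : PPT fun a : ℕ × Val × Val => E.encode a.1 a.2.2 :=
    hE.ppt_encode.comp (f := fun a : ℕ × Val × Val => (a.1, a.2.2)) (by fun_prop)
  have h2 : PPT fun a : ((ℕ × Val × Val) × Val) × Val => S.enc a.1.1.1 a.2 a.1.2 :=
    hS.ppt_enc.comp (f := fun a : ((ℕ × Val × Val) × Val) × Val => (a.1.1.1, a.2, a.1.2))
      (by fun_prop)
  have h3 : PPT fun a : (ℕ × Val × Val) × Val =>
      (sampleList (a.1.2.1.toList.map fun pki => S.enc a.1.1 pki a.2)).map Val.ofList :=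
    (PPT.sampleList_map h2 (l := fun a => a.1.2.1.toList) (by fun_prop)).map dpt_ofList
  exact h1.bind_prod h3

/-! ### Mixing two lists of keys -/

section Mixing

variable {γ δ : Type}

/-- The pairs of the entries of `A` and `B`, with the entry of `A` in the place given by the
bit. -/
def mixKeys (vk : List Bool) (A B : List γ) : List (γ × γ) :=
  (vk.zip (A.zip B)).map fun x => bif x.1 then (x.2.2, x.2.1) else x.2

/-- The selection of one entry from each pair. -/
def selectKeys (keys : List (γ × γ)) (v : List Bool) : List γ :=
  List.zipWith (fun a b => bif b then a.2 else a.1) keys v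

theorem mixKeys_cons (b : Bool) (vk : List Bool) (x y : γ) (A B : List γ) :
    mixKeys (b :: vk) (x :: A) (y :: B) = (bif b then (y, x) else (x, y)) :: mixKeys vk A B := rfl

theorem mixKeys_map (f : γ → δ) (vk : List Bool) (A B : List γ) :
    mixKeys vk (A.map f) (B.map f) = (mixKeys vk A B).map fun x => (f x.1, f x.2) := by
  induction vk generalizing A B with
  | nil => rfl
  | cons b vk ih =>
    cases A with
    | nil => rfl
    | cons x A =>
      cases B with
      | nil => rfl
      | cons y B => cases b <;> simp [mixKeys_cons, ih]

theorem length_mixKeys {vk : List Bool} {A B : List γ} (hA : A.length = vk.length)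
    (hB : B.length = vk.length) : (mixKeys vk A B).length = vk.length := by
  simp [mixKeys, hA, hB]

/-- This makes the encryption under `vk` in the simulated scheme an encryption under exactly the
challenge keys `A`. -/
theorem selectKeys_mixKeys {vk : List Bool} {A B : List γ} (hA : A.length = vk.length)
    (hB : B.length = vk.length) : selectKeys (mixKeys vk A B) vk = A := by
  induction vk generalizing A B with
  | nil => simpa [mixKeys, selectKeys, eq_comm] using hA
  | cons b vk ih =>
    cases A with
    | nil => simp at hA
    | cons x A =>
      cases B with
      | nil => simp at hB
      | cons y B =>
        simp only [List.length_cons, Nat.add_right_cancel_iff] at hA hB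
        have h := ih hA hB
        simp only [selectKeys] at h
        cases b <;> simp [mixKeys_cons, selectKeys, h]

/-- Where the bit differs, the entry of `B` is selected. -/
theorem selectKeys_mixKeys_of_ne {vk v : List Bool} {A B : List γ} (hA : A.length = vk.length)
    {i : ℕ} {b b' : Bool} {y : γ} (hv : v[i]? = some b) (hvk : vk[i]? = some b') (hne : b ≠ b')
    (hy : B[i]? = some y) : (selectKeys (mixKeys vk A B) v)[i]? = some y := by
  obtain ⟨hi, -⟩ := List.getElem?_eq_some_iff.1 hvk
  obtain ⟨x, hx⟩ : ∃ x, A[i]? = some x := ⟨_, List.getElem?_eq_getElem (hA ▸ hi)⟩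
  simp only [selectKeys, mixKeys, List.getElem?_zipWith, List.getElem?_map, List.zip, hv, hvk, hx, hy]
  cases b <;> cases b' <;> simp_all

theorem mem_of_mem_mixKeys {vk : List Bool} {A B : List γ} {x : γ × γ} (h : x ∈ mixKeys vk A B) :
    (x.1 ∈ A ∨ x.1 ∈ B) ∧ (x.2 ∈ A ∨ x.2 ∈ B) := by
  simp only [mixKeys, List.mem_map] at h
  obtain ⟨⟨b, y, z⟩, h, rfl⟩ := h
  have h1 := List.of_mem_zip h
  have h2 := List.of_mem_zip h1.2
  cases b <;> simp [h2]

theorem mem_of_mem_selectKeys {keys : List (γ × γ)} {v : List Bool} {x : γ}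
    (h : x ∈ selectKeys keys v) : ∃ y ∈ keys, x = y.1 ∨ x = y.2 := by
  rw [selectKeys, ← List.map_uncurry_zip_eq_zipWith] at h
  simp only [List.mem_map] at h
  obtain ⟨⟨y, b⟩, h, rfl⟩ := h
  exact ⟨y, (List.of_mem_zip h).1, by cases b <;> simp [Function.uncurry]⟩

/-- Exchanging two independent samples of the same distribution does not change their joint
distribution. The mixed keys are therefore distributed like the keys of the scheme, whatever `vk`
is. -/
theorem sampleList_mixKeys (G : PMF γ) (vk : List Bool) :
    ((sampleList (vk.map fun _ => G)).bind fun A => (sampleList (vk.map fun _ => G)).bind fun B =>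
      PMF.pure (mixKeys vk A B)) =
    sampleList (vk.map fun _ => G.bind fun x => G.bind fun y => PMF.pure (x, y)) := by
  induction vk with
  | nil => simp [sampleList, mixKeys]
  | cons b vk ih =>
    simp only [List.map_cons, sampleList, PMF.bind_bind, PMF.pure_bind, mixKeys_cons, ← ih]
    simp_rw [PMF.bind_comm (sampleList (vk.map fun _ => G)) G]
    cases b with
    | false => rfl
    | true =>
      rw [PMF.bind_comm]
      rfl

theorem mem_support_sampleList {l : List (PMF γ)} {a : List γ} :
    a ∈ (sampleList l).support ↔ List.Forall₂ (fun p x => x ∈ p.support) l a := by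
  induction l generalizing a with
  | nil => simp [sampleList]
  | cons p l ih =>
    simp only [sampleList, PMF.mem_support_bind_iff, PMF.support_pure, Set.mem_singleton_iff, ih,
      List.forall₂_cons_left_iff]
    constructor
    · rintro ⟨x, hx, xs, hxs, rfl⟩
      exact ⟨x, xs, hx, hxs, rfl⟩
    · rintro ⟨x, xs, hx, hxs, rfl⟩
      exact ⟨x, hx, xs, hxs, rfl⟩

theorem mem_support_sampleList_const {ι : Type} {l : List ι} {G : PMF γ} {a : List γ} :
    a ∈ (sampleList (l.map fun _ => G)).support ↔
      a.length = l.length ∧ ∀ x ∈ a, x ∈ G.support := by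
  rw [mem_support_sampleList]
  induction l generalizing a with
  | nil => cases a <;> simp
  | cons i l ih =>
    cases a with
    | nil => simp
    | cons x a =>
      simp only [List.map_cons, List.forall₂_cons, ih, List.length_cons, Nat.add_right_cancel_iff,
        List.forall_mem_cons]
      tauto

end Mixing

/-! ### Simulation of the decryption oracle -/

/-- What is needed to simulate the decryption oracle: the security parameter, the verification key
of the challenge ciphertext, the public key and the known secret keys. -/
abbrev SimCtx : Type := ℕ × List Bool × Val × List Val

/-- Decryption with the known secret keys; it answers `nil` to all queries with the verification
key of the challenge ciphertext. -/
def simDec (S : PKE) (E : RandomizedEncoding) (SS : SignatureScheme)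
    (V : ℕ × Val × Val × ℕ × Val → Bool) (a : SimCtx) (q : Val) : Val :=
  bif decide (q = Val.pair q.fst (Val.pair q.snd.fst q.snd.snd)) &&
      decide (Val.ofBits q.snd.fst.toBits = q.snd.fst) &&
      decide (q.snd.fst.toBits.length = a.2.1.length) &&
      SS.ver a.1 q.snd.fst.toBits q.fst q.snd.snd &&
      decide (Val.ofList q.fst.toList = q.fst) &&
      decide (q.fst.toList.length = a.2.1.length) then
    -- Each place carries the known secret key and the ciphertext component there, so the search
    -- also delivers what is to be decrypted.
    (findDiffer ((q.snd.fst.toBits.zip a.2.1).zip (a.2.2.2.zip q.fst.toList))).2.elim Val.nil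
      fun x =>
        -- Acceptance guarantees that all components give one common message of the message space.
        -- Decrypting a single component then suffices, and membership in the message space need not
        -- be decided.
        bif V (a.1, q.fst, derivedKey a.2.2.1 q.snd.fst.toBits,
          (findDiffer ((q.snd.fst.toBits.zip a.2.1).zip (a.2.2.2.zip q.fst.toList))).1, x.1) then
          Val.ofOption ((S.dec a.1 x.1 x.2).elim none (E.decode a.1))
        else Val.nil
  else Val.nil

/-- The queries, other than `ch`, with a valid signature for the verification key of the challenge
ciphertext. -/
def forgery (SS : SignatureScheme) (a : SimCtx) (ch q : Val) : Bool :=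
  !decide (q = ch) && decide (q = Val.pair q.fst (Val.pair (Val.ofBits a.2.1) q.snd.snd)) &&
    SS.ver a.1 a.2.1 q.fst q.snd.snd

section Efficiency

variable {S : PKE} {E : RandomizedEncoding} {SS : SignatureScheme}
  {V : ℕ × Val × Val × ℕ × Val → Bool}

theorem dpt_simDec (hS : S.Efficient) (hE : E.Efficient) (hSS : SS.Efficient)
    (hV : DPT V) : DPT fun a : SimCtx × Val => simDec S E SS V a.1 a.2 := by
  have h1 : DPT fun a : SimCtx × Val =>
      SS.ver a.1.1 a.2.snd.fst.toBits a.2.fst a.2.snd.snd :=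
    hSS.dpt_ver.comp (f := fun a : SimCtx × Val =>
      (a.1.1, a.2.snd.fst.toBits, a.2.fst, a.2.snd.snd)) (by fun_prop)
  have h2 : DPT fun a : SimCtx × Val =>
      findDiffer ((a.2.snd.fst.toBits.zip a.1.2.1).zip (a.1.2.2.2.zip a.2.fst.toList)) :=
    DPT.findDiffer (by fun_prop)
  have h3 : DPT fun a : (SimCtx × Val) × Val × Val => S.dec a.1.1.1 a.2.1 a.2.2 :=
    hS.dpt_dec.comp (f := fun a : (SimCtx × Val) × Val × Val => (a.1.1.1, a.2.1, a.2.2))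
      (by fun_prop)
  have h4 : DPT fun a : ((SimCtx × Val) × Val × Val) × Val => E.decode a.1.1.1.1 a.2 :=
    hE.dpt_decode.comp (f := fun a : ((SimCtx × Val) × Val × Val) × Val => (a.1.1.1.1, a.2))
      (by fun_prop)
  have h5 : DPT fun a : (SimCtx × Val) × Val × Val =>
      (S.dec a.1.1.1 a.2.1 a.2.2).elim none (E.decode a.1.1.1) :=
    DPT.option_elim h3 (dpt_const _) h4
  have h6 : DPT fun a : (SimCtx × Val) × Val × Val => derivedKey a.1.1.2.2.1 a.1.2.snd.fst.toBits :=
    dpt_derivedKey.comp (f := fun a : (SimCtx × Val) × Val × Val =>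
      (a.1.1.2.2.1, a.1.2.snd.fst.toBits)) (by fun_prop)
  have h7 : DPT fun a : (SimCtx × Val) × Val × Val => V (a.1.1.1, a.1.2.fst,
      derivedKey a.1.1.2.2.1 a.1.2.snd.fst.toBits, (findDiffer ((a.1.2.snd.fst.toBits.zip
        a.1.1.2.1).zip (a.1.1.2.2.2.zip a.1.2.fst.toList))).1, a.2.1) :=
    hV.comp (((dpt_fst.comp dpt_fst).comp dpt_fst).prodMk (DPT.prodMk (by fun_prop) (h6.prodMk
      ((dpt_fst.comp (h2.comp dpt_fst)).prodMk (dpt_fst.comp dpt_snd)))))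
  have h8 : DPT fun a : SimCtx × Val =>
      (findDiffer ((a.2.snd.fst.toBits.zip a.1.2.1).zip (a.1.2.2.2.zip a.2.fst.toList))).2.elim
        Val.nil fun x => bif V (a.1.1, a.2.fst, derivedKey a.1.2.2.1 a.2.snd.fst.toBits,
          (findDiffer ((a.2.snd.fst.toBits.zip a.1.2.1).zip (a.1.2.2.2.zip a.2.fst.toList))).1,
            x.1) then Val.ofOption ((S.dec a.1.1 x.1 x.2).elim none (E.decode a.1.1))
        else Val.nil :=
    DPT.option_elim (by fun_prop) (dpt_const _) (DPT.cond h7 (by fun_prop) (dpt_const _))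
  unfold simDec
  fun_prop

theorem dpt_forgery (hSS : SS.Efficient) :
    DPT fun a : (SimCtx × Val) × Val => forgery SS a.1.1 a.1.2 a.2 := by
  have h1 : DPT fun a : (SimCtx × Val) × Val =>
      SS.ver a.1.1.1 a.1.1.2.1 a.2.fst a.2.snd.snd :=
    hSS.dpt_ver.comp (f := fun a : (SimCtx × Val) × Val =>
      (a.1.1.1, a.1.1.2.1, a.2.fst, a.2.snd.snd)) (by fun_prop)
  unfold forgery
  fun_prop

end Efficiency

/-! ### Correctness of the simulated decryption oracle. -/

theorem derivedKey_ofList (keys : List (Val × Val)) (v : List Bool) :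
    derivedKey (Val.ofList (keys.map fun x => Val.pair x.1 x.2)) v =
      Val.ofList (selectKeys keys v) := by
  rw [derivedKey, Val.toList_ofList, selectKeys]
  congr 1
  induction keys generalizing v with
  | nil => rfl
  | cons x keys ih =>
    cases v with
    | nil => rfl
    | cons b v => cases b <;> simp [ih]

theorem selectKeys_map {γ δ : Type} (f : γ → δ) (keys : List (γ × γ)) (v : List Bool) :
    selectKeys (keys.map fun x => (f x.1, f x.2)) v = (selectKeys keys v).map f := by
  simp only [selectKeys, List.zipWith_map_left, List.map_zipWith]
  congr 1
  funext a b
  cases b <;> rfl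

/-- What a decryption of the repetition says about the single components. -/
theorem PKE.repetition_dec_eq_some {S : PKE} {E : RandomizedEncoding} {k : ℕ → ℕ} {n : ℕ}
    {sk c m : Val} (h : (S.repetition E k).dec n sk c = some m) {i : ℕ} {ski ci : Val}
    (hsk : sk.toList[i]? = some ski) (hc : c.toList[i]? = some ci) :
    (S.dec n ski ci).bind (E.decode n) = some m := by
  have hmem : (S.dec n ski ci).bind (E.decode n) ∈
      List.zipWith (fun ski ci => (S.dec n ski ci).bind (E.decode n)) sk.toList c.toList := by
    refine List.mem_iff_getElem?.2 ⟨i, ?_⟩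
    rw [List.getElem?_zipWith, hsk, hc]
  simp only [PKE.repetition] at h
  split_ifs at h
  split at h
  · split_ifs at h with h'
    rw [Option.some.injEq] at h
    subst h
    exact h'.2 _ hmem
  · simp at h

theorem PKE.repetition_dec_eq_none {S : PKE} {E : RandomizedEncoding} {k : ℕ → ℕ} {n : ℕ}
    {sk c : Val} (h : ¬ (Val.ofList c.toList = c ∧ c.toList.length = k n)) :
    (S.repetition E k).dec n sk c = none := by
  simp only [PKE.repetition, if_neg h]

/-- The key material of the simulation. -/
def simCtx (n : ℕ) (vk : List Bool) (pk : Val) (B : List (Val × Val)) : SimCtx :=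
  (n, vk, Val.ofList ((mixKeys vk pk.toList (B.map Prod.fst)).map fun x => Val.pair x.1 x.2),
    B.map Prod.snd)

/-- The secret key of the simulated scheme. -/
def mixedSecret (vk : List Bool) (A B : List (Val × Val)) : Val :=
  Val.ofList ((mixKeys vk A B).map fun x => Val.pair x.1.2 x.2.2)

theorem derivedKey_mixedSecret (vk v : List Bool) (A B : List (Val × Val)) :
    derivedKey (mixedSecret vk A B) v =
      Val.ofList ((selectKeys (mixKeys vk A B) v).map Prod.snd) := by
  rw [← selectKeys_map, ← derivedKey_ofList, List.map_map]
  rfl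

theorem derivedKey_simCtx (n : ℕ) (vk v : List Bool) (A B : List (Val × Val)) :
    derivedKey (simCtx n vk (Val.ofList (A.map Prod.fst)) B).2.2.1 v =
      Val.ofList ((selectKeys (mixKeys vk A B) v).map Prod.fst) := by
  rw [← selectKeys_map, ← derivedKey_ofList, simCtx, Val.toList_ofList, mixKeys_map]

/-- Verifiability speaks only of keys in the range of the key generation. Any selection `v` from the
mixed keys consists of `k n` honestly generated pairs, so it qualifies. -/
theorem selectKeys_mem_support_repetition_gen {S : PKE} {E : RandomizedEncoding} {k : ℕ → ℕ}
    {n : ℕ} {vk v : List Bool} (hvk : vk.length = k n) (hv : v.length = k n) {A B : List (Val × Val)}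
    (hA : A ∈ (sampleList (vk.map fun _ => S.gen n)).support)
    (hB : B ∈ (sampleList (vk.map fun _ => S.gen n)).support) :
    (Val.ofList ((selectKeys (mixKeys vk A B) v).map Prod.fst),
      Val.ofList ((selectKeys (mixKeys vk A B) v).map Prod.snd)) ∈
        ((S.repetition E k).gen n).support := by
  simp only [PKE.repetition, PMF.mem_support_map_iff]
  refine ⟨_, ?_, rfl⟩
  rw [← hvk, ← List.map_const', mem_support_sampleList_const]
  rw [mem_support_sampleList_const] at hA hB
  refine ⟨?_, fun x hx => ?_⟩
  · simp [selectKeys, length_mixKeys hA.1 hB.1, hv, hvk]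
  · obtain ⟨y, hy, rfl | rfl⟩ := mem_of_mem_selectKeys hx
    · exact (mem_of_mem_mixKeys hy).1.elim (hA.2 _) (hB.2 _)
    · exact (mem_of_mem_mixKeys hy).2.elim (hA.2 _) (hB.2 _)

/-- Queries that are malformed or have an invalid signature are refused by both sides. Otherwise, if
the verification key of `q` differs from `vk` at place `i`, the secret key selected there is that of
`B[i]`: `V` tells with it whether the repetition decrypts, and the `i`-th component gives the
message. If the verification key is `vk`, the query is a forgery, against `hf`. -/
theorem simDec_eq {S : PKE} {E : RandomizedEncoding} {SS : SignatureScheme} {k : ℕ → ℕ}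
    {V : ℕ × Val × Val × ℕ × Val → Bool}
    (hV : ∀ n, ∀ key ∈ ((S.repetition E k).gen n).support,
      ∀ c : List Val, c.length = k n →
        ∀ (i : ℕ) (ski : Val), key.2.toList[i]? = some ski →
          (V (n, Val.ofList c, key.1, i, ski) = true ↔
            ∃ m, (S.repetition E k).dec n key.2 (Val.ofList c) = some m))
    {n : ℕ} {vk : List Bool} (hvk : vk.length = k n) {A B : List (Val × Val)}
    (hA : A ∈ (sampleList (vk.map fun _ => S.gen n)).support)
    (hB : B ∈ (sampleList (vk.map fun _ => S.gen n)).support) {ch q : Val}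
    (hq : q ≠ ch)
    (hf : ¬ forgery SS (simCtx n vk (Val.ofList (A.map Prod.fst)) B) ch q = true) :
    simDec S E SS V (simCtx n vk (Val.ofList (A.map Prod.fst)) B) q =
      Val.ofOption ((S.cca2 E SS k).dec n (mixedSecret vk A B) q) := by
  by_cases hform : q = Val.pair q.fst (Val.pair q.snd.fst q.snd.snd)
  swap
  · have h1 : (S.cca2 E SS k).dec n (mixedSecret vk A B) q = none := by
      simp only [PKE.cca2]
      split
      · simp at hform
      · rfl
    simp only [h1, simDec, decide_eq_false hform, Bool.false_and, cond_false]
    rfl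
  obtain ⟨c, w, sig, rfl⟩ : ∃ c w sig, q = Val.pair c (Val.pair w sig) := ⟨_, _, _, hform⟩
  simp only [PKE.cca2, simDec, Val.fst_pair, Val.snd_pair, derivedKey_mixedSecret,
    derivedKey_simCtx]
  by_cases hw : Val.ofBits w.toBits = w
  swap
  · simp [hw, Val.ofOption]
  by_cases hlen : w.toBits.length = k n
  swap
  · simp [hlen, simCtx, hvk, Val.ofOption]
  by_cases hver : SS.ver n w.toBits c sig = true
  swap
  · simp [hver, simCtx, Val.ofOption]
  by_cases hc : Val.ofList c.toList = c ∧ c.toList.length = k n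
  swap
  · rw [PKE.repetition_dec_eq_none hc]
    simp only [ite_self]
    by_cases hc' : Val.ofList c.toList = c
    · have hc'' : ¬ c.toList.length = k n := fun h => hc ⟨hc', h⟩
      simp [simCtx, hvk, hc'', Val.ofOption]
    · simp [hc', Val.ofOption]
  have hkey := selectKeys_mem_support_repetition_gen (E := E) hvk hlen hA hB
  rw [mem_support_sampleList_const] at hA hB
  simp only [simCtx, hw, hlen, hver, hc.1, hc.2, hvk, decide_true, Bool.and_true, cond_true,
    and_self, if_true]
  rcases findDiffer_spec ((w.toBits.zip vk).zip ((B.map Prod.snd).zip c.toList)) with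
    ⟨i, ⟨⟨b, b'⟩, ski, ci⟩, h1, h2, h3⟩ | ⟨h1, h2⟩
  · simp only [List.getElem?_zip_eq_some] at h2
    obtain ⟨⟨hb, hb'⟩, hski, hci⟩ := h2
    obtain ⟨key, hkey', rfl⟩ : ∃ key, B[i]? = some key ∧ key.2 = ski := by
      rw [List.getElem?_map, Option.map_eq_some_iff] at hski
      exact hski
    have hsel := selectKeys_mixKeys_of_ne hA.1 hb hb' h3 hkey'
    have hsk : (Val.ofList ((selectKeys (mixKeys vk A B) w.toBits).map Prod.snd)).toList[i]? =
        some key.2 := by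
      rw [Val.toList_ofList, List.getElem?_map, hsel]
      rfl
    have hVi := hV n _ hkey c.toList hc.2 i key.2 hsk
    simp only [hc.1] at hVi
    simp only [h1, Option.elim_some]
    by_cases hacc : ∃ m, (S.repetition E k).dec n
        (Val.ofList ((selectKeys (mixKeys vk A B) w.toBits).map Prod.snd)) c = some m
    · rw [hVi.2 hacc, cond_true]
      obtain ⟨m, hm⟩ := hacc
      have h4 := PKE.repetition_dec_eq_some hm hsk hci
      rw [hm, ← h4]
      cases S.dec n key.2 ci <;> rfl
    · rw [Bool.eq_false_iff.2 fun h => hacc (hVi.1 h), cond_false]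
      cases hd : (S.repetition E k).dec n
        (Val.ofList ((selectKeys (mixKeys vk A B) w.toBits).map Prod.snd)) c with
      | none => rfl
      | some m => exact absurd ⟨m, hd⟩ hacc
  -- The four zipped lists all have length `k n`, so the zips lose no place, and finding no
  -- difference means equality.
  · have hwvk : w.toBits = vk := by
      refine List.ext_getElem (by rw [hlen, hvk]) fun i hi hi' => ?_
      have hB' : i < (B.map Prod.snd).length := by
        rw [List.length_map, hB.1]
        exact hi'
      have hc' : i < c.toList.length := by
        rw [hc.2, ← hvk]
        exact hi'
      refine h2 ((w.toBits[i], vk[i]), ((B.map Prod.snd)[i], c.toList[i]))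
        (List.mem_iff_getElem?.2 ⟨i, ?_⟩)
      simp only [List.getElem?_zip_eq_some]
      simp only [List.getElem?_eq_getElem, hi, hi', hB', hc', and_self]
    refine absurd ?_ hf
    subst hwvk
    simp [forgery, simCtx, hq, hw, hver]

theorem Val.toBits_ofBits (l : List Bool) : (Val.ofBits l).toBits = l := by
  rw [Val.toBits, Val.ofBits, Val.toList_ofList, List.map_map]
  simp [Function.comp_def]

/-- `vk` does not differ from itself, so the search finds no key to decrypt with. The simulation
thus refuses the challenge without knowing it, as the second-stage oracle does. -/
theorem simDec_challenge (S : PKE) (E : RandomizedEncoding) (SS : SignatureScheme)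
    (V : ℕ × Val × Val × ℕ × Val → Bool) (a : SimCtx) (c sig : Val) :
    simDec S E SS V a (Val.pair c (Val.pair (Val.ofBits a.2.1) sig)) = Val.nil := by
  simp only [simDec, Val.fst_pair, Val.snd_pair, Val.toBits_ofBits]
  rcases findDiffer_spec ((a.2.1.zip a.2.1).zip (a.2.2.2.zip c.toList)) with
    ⟨i, ⟨⟨b, b'⟩, x⟩, h1, h2, h3⟩ | ⟨h1, -⟩
  · simp only [List.getElem?_zip_eq_some] at h2
    have h4 := h2.1.1.symm.trans h2.1.2
    rw [Option.some.injEq] at h4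
    exact absurd h4 h3
  · rw [h1, Option.elim_none, Bool.cond_self]

/-- Moves the generation of the signature keys, which belongs to the encryption, ahead of the first
stage; the branch without encryption ignores the sample. -/
theorem PMF.bind_ite_comm {α β γ δ : Type} (μ : PMF α) (ν : PMF β) (κ : PMF γ) (P : α → Prop)
    [DecidablePred P] (f : α → γ → β → PMF δ) (g : α → PMF δ) :
    (μ.bind fun a => if P a then κ.bind fun c => ν.bind fun b => f a c b else g a) =
      ν.bind fun b => μ.bind fun a => if P a then κ.bind fun c => f a c b else g a := by
  rw [PMF.bind_comm ν μ]
  congr 1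
  funext a
  split_ifs
  · exact PMF.bind_comm _ _ _
  · exact (PMF.bind_const _ _).symm

/-! ### The games -/

section Games

variable (S : PKE) (E : RandomizedEncoding) (SS : SignatureScheme) (k : ℕ → ℕ) (A₁ A₂ : Prog)

/-- The challenge ciphertext. -/
def challenge (a : SimCtx) (c sig : Val) : Val := Val.pair c (Val.pair (Val.ofBits a.2.1) sig)

open Classical in
/-- The part of the security experiment after the generation of the keys, with oracles `O₁` and
`O₂`.  The second bit of the result tells whether a forgery has been among the queries. -/
noncomputable def challengeGame (a : SimCtx) (pk dsk : Val) (O₁ : Val → Val) (O₂ : Val → Val → Val) :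
    PMF (Bool × Bool) :=
  (A₁.runLog O₁ ([], Val.pair (Val.unary a.1) a.2.2.1)).bind fun r =>
  if r.2.fst ∈ E.msg a.1 ∧ r.2.snd.fst ∈ E.msg a.1 ∧ r.2.fst.size = r.2.snd.fst.size then
    fairCoin.bind fun b =>
    ((S.repetition E k).enc a.1 pk (if b then r.2.snd.fst else r.2.fst)).bind fun c =>
    (SS.sign a.1 dsk c).bind fun sig =>
    (A₂.runLog (O₂ (challenge a c sig)) ([], Val.pair (challenge a c sig) r.2.snd.snd)).bind
      fun g => PMF.pure (decide (g.2 = Val.bit true) == b,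
        -- There is no challenge yet in the first stage; `Val.nil`, which is not of the form of a
        -- ciphertext, takes its place.
        r.1.any (forgery SS a Val.nil) || g.1.any (forgery SS a (challenge a c sig)))
  else fairCoin.bind fun w => PMF.pure (w, r.1.any (forgery SS a Val.nil))

/-- Outcomes with second bit `false` come only from runs without forgeries in either stage, and on
those `Prog.runLog_congr` applies stage by stage. -/
theorem challengeGame_congr {a : SimCtx} {pk dsk : Val} {O₁ O₁' : Val → Val}
    {O₂ O₂' : Val → Val → Val} (h₁ : ∀ z, ¬ forgery SS a Val.nil z = true → O₁ z = O₁' z)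
    (h₂ : ∀ c sig z, ¬ forgery SS a (challenge a c sig) z = true →
      O₂ (challenge a c sig) z = O₂' (challenge a c sig) z) (w : Bool) :
    challengeGame S E SS k A₁ A₂ a pk dsk O₁ O₂ (w, false) =
      challengeGame S E SS k A₁ A₂ a pk dsk O₁' O₂' (w, false) := by
  refine PMF.bind_apply_congr fun r => ?_
  by_cases hr : r.1.any (forgery SS a Val.nil) = true
  · refine Or.inr ⟨?_, ?_⟩
    all_goals
      rw [PMF.apply_eq_zero_iff]
      simp only [hr, Bool.true_or]
      split_ifs <;> simp
  · refine Or.inl ⟨Prog.runLog_congr h₁ _ _ _ fun z hz h => hr (List.any_eq_true.2 ⟨z, hz, h⟩), ?_⟩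
    split_ifs
    · refine PMF.bind_apply_congr fun b => Or.inl ⟨rfl, ?_⟩
      refine PMF.bind_apply_congr fun c => Or.inl ⟨rfl, ?_⟩
      refine PMF.bind_apply_congr fun sig => Or.inl ⟨rfl, ?_⟩
      refine PMF.bind_apply_congr fun g => ?_
      by_cases hg : g.1.any (forgery SS a (challenge a c sig)) = true
      · exact Or.inr ⟨by simp [hg], by simp [hg]⟩
      · exact Or.inl ⟨Prog.runLog_congr (h₂ c sig) _ _ _
          fun z hz h => hg (List.any_eq_true.2 ⟨z, hz, h⟩), rfl⟩
    · rfl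

open Classical in
/-- The same part of the experiment, without the lists of the queries. -/
noncomputable def plainGame (a : SimCtx) (pk dsk : Val) (O₁ : Val → Val) (O₂ : Val → Val → Val) :
    PMF Bool :=
  (A₁.outO O₁ (Val.pair (Val.unary a.1) a.2.2.1)).bind fun y =>
  if y.fst ∈ E.msg a.1 ∧ y.snd.fst ∈ E.msg a.1 ∧ y.fst.size = y.snd.fst.size then
    fairCoin.bind fun b =>
    ((S.repetition E k).enc a.1 pk (if b then y.snd.fst else y.fst)).bind fun c =>
    (SS.sign a.1 dsk c).bind fun sig =>
    (A₂.outO (O₂ (challenge a c sig)) (Val.pair (challenge a c sig) y.snd.snd)).bind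
      fun g => PMF.pure (decide (g = Val.bit true) == b)
  else fairCoin

theorem challengeGame_map_fst (a : SimCtx) (pk dsk : Val) (O₁ : Val → Val)
    (O₂ : Val → Val → Val) :
    (challengeGame S E SS k A₁ A₂ a pk dsk O₁ O₂).map Prod.fst =
      plainGame S E SS k A₁ A₂ a pk dsk O₁ O₂ := by
  rw [challengeGame, plainGame, PMF.map_bind,
    ← Prog.runLog_map_snd _ _ ([], Val.pair (Val.unary a.1) a.2.2.1), PMF.bind_map]
  congr 1
  funext r
  simp only [Function.comp]
  split_ifs
  · simp only [PMF.map_bind, PMF.pure_map]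
    congr 1
    funext b
    congr 1
    funext c
    congr 1
    funext sig
    rw [← Prog.runLog_map_snd _ _ ([], Val.pair (challenge a c sig) r.2.snd.snd), PMF.bind_map]
    rfl
  · simp [PMF.map_bind, PMF.pure_map]

/-- The experiment with oracles `O₁` and `O₂` that depend on the secret key and on the context of
the simulation. -/
noncomputable def keyedGame (O₁ : Val → SimCtx → Val → Val) (O₂ : Val → SimCtx → Val → Val → Val)
    (n : ℕ) : PMF (Bool × Bool) :=
  (SS.gen n).bind fun key =>
  (sampleList (key.1.map fun _ => S.gen n)).bind fun A =>
  (sampleList (key.1.map fun _ => S.gen n)).bind fun B =>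
  challengeGame S E SS k A₁ A₂ (simCtx n key.1 (Val.ofList (A.map Prod.fst)) B)
    (Val.ofList (A.map Prod.fst)) key.2
    (O₁ (mixedSecret key.1 A B) (simCtx n key.1 (Val.ofList (A.map Prod.fst)) B))
    (O₂ (mixedSecret key.1 A B) (simCtx n key.1 (Val.ofList (A.map Prod.fst)) B))

/-- The experiment with the decryption oracle. -/
noncomputable def realGame (n : ℕ) : PMF (Bool × Bool) :=
  keyedGame S E SS k A₁ A₂ (fun sk a q => Val.ofOption ((S.cca2 E SS k).dec a.1 sk q))
    (fun sk a ch q => if q = ch then Val.nil else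
      Val.ofOption ((S.cca2 E SS k).dec a.1 sk q)) n

/-- The experiment with the simulated decryption oracle. -/
noncomputable def simGame (V : ℕ × Val × Val × ℕ × Val → Bool) (n : ℕ) : PMF (Bool × Bool) :=
  keyedGame S E SS k A₁ A₂ (fun _ a q => simDec S E SS V a q) (fun _ a _ q => simDec S E SS V a q) n

variable {S E SS k}

theorem realGame_apply_eq {V : ℕ × Val × Val × ℕ × Val → Bool}
    (hvk : ∀ n, ∀ key ∈ (SS.gen n).support, key.1.length = k n)
    (hV : ∀ n, ∀ key ∈ ((S.repetition E k).gen n).support,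
      ∀ c : List Val, c.length = k n →
        ∀ (i : ℕ) (ski : Val), key.2.toList[i]? = some ski →
          (V (n, Val.ofList c, key.1, i, ski) = true ↔
            ∃ m, (S.repetition E k).dec n key.2 (Val.ofList c) = some m)) (n : ℕ) (w : Bool) :
    realGame S E SS k A₁ A₂ n (w, false) = simGame S E SS k A₁ A₂ V n (w, false) := by
  refine PMF.bind_apply_congr_support fun key hkey => PMF.bind_apply_congr_support fun A hA =>
    PMF.bind_apply_congr_support fun B hB => ?_
  have h : ∀ ch z, z ≠ ch → ¬ forgery SS (simCtx n key.1 (Val.ofList (A.map Prod.fst)) B) ch z =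
      true → Val.ofOption ((S.cca2 E SS k).dec n (mixedSecret key.1 A B) z) =
        simDec S E SS V (simCtx n key.1 (Val.ofList (A.map Prod.fst)) B) z :=
    fun ch z hne hz => (simDec_eq hV (hvk n key hkey) hA hB hne hz).symm
  refine challengeGame_congr S E SS k A₁ A₂ (fun z hz => ?_) (fun c sig z hz => ?_) w
  -- `simDec_eq` leaves out the query equal to the challenge, here the stand-in `Val.nil`; it is
  -- malformed, so both oracles answer `nil`.
  · by_cases hz' : z = Val.nil
    · subst hz'
      rfl
    · exact h _ z hz' hz
  · by_cases hz' : z = challenge (simCtx n key.1 (Val.ofList (A.map Prod.fst)) B) c sig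
    · refine (if_pos hz').trans ?_
      rw [hz']
      exact (simDec_challenge ..).symm
    · exact (if_neg hz').trans (h _ z hz' hz)

/-- The simulation samples one key pair for each bit of `vk`, so it needs no program that computes
`k`. -/
theorem sampleList_replicate_eq {vk : List Bool} {n : ℕ} (hvk : vk.length = k n) {γ : Type}
    (G : PMF γ) : sampleList (List.replicate (k n) G) = sampleList (vk.map fun _ => G) := by
  rw [List.map_const', hvk]

-- The signature keys are moved to the front; then, for fixed `vk`, the `2k` key pairs are rewritten
-- as the mixture of two independent lists `A` and `B`.
open Classical in
theorem cca2Experiment_eq (hvk : ∀ n, ∀ key ∈ (SS.gen n).support, key.1.length = k n) (n : ℕ) :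
    (S.cca2 E SS k).cca2Experiment A₁ A₂ n = (realGame S E SS k A₁ A₂ n).map Prod.fst := by
  simp only [realGame, keyedGame, PMF.map_bind, challengeGame_map_fst]
  have hexp : (S.cca2 E SS k).cca2Experiment A₁ A₂ n =
      ((S.cca2 E SS k).gen n).bind fun key =>
      (A₁.outO (fun q => Val.ofOption ((S.cca2 E SS k).dec n key.2 q))
        (Val.pair (Val.unary n) key.1)).bind fun y =>
      if y.fst ∈ E.msg n ∧ y.snd.fst ∈ E.msg n ∧ y.fst.size = y.snd.fst.size then
        fairCoin.bind fun b =>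
        ((S.cca2 E SS k).enc n key.1 (if b then y.snd.fst else y.fst)).bind fun c =>
        (A₂.outO (fun q => if q = c then Val.nil else
          Val.ofOption ((S.cca2 E SS k).dec n key.2 q)) (Val.pair c y.snd.snd)).bind
          fun g => PMF.pure (decide (g = Val.bit true) == b)
      else fairCoin := rfl
  have henc : ∀ pk m, (S.cca2 E SS k).enc n pk m = (SS.gen n).bind fun skey =>
      ((S.repetition E k).enc n (derivedKey pk skey.1) m).bind fun c₀ =>
      (SS.sign n skey.2 c₀).bind fun sig =>
      PMF.pure (Val.pair c₀ (Val.pair (Val.ofBits skey.1) sig)) := fun _ _ => rfl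
  have hgen : (S.cca2 E SS k).gen n = (sampleList (List.replicate (k n)
      ((S.gen n).bind fun key₀ => (S.gen n).bind fun key₁ => PMF.pure (key₀, key₁)))).map
      fun keys => (Val.ofList (keys.map fun a => Val.pair a.1.1 a.2.1),
        Val.ofList (keys.map fun a => Val.pair a.1.2 a.2.2)) := rfl
  rw [hexp]
  simp only [hgen, henc, PMF.bind_map, Function.comp_def, PMF.bind_bind, PMF.pure_bind]
  -- The signature keys pass the message choice here, and the key generation in the next step.
  simp only [PMF.bind_ite_comm]
  rw [PMF.bind_comm]
  refine PMF.bind_congr_support fun key hkey => ?_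
  rw [sampleList_replicate_eq (hvk n key hkey), ← sampleList_mixKeys, PMF.bind_bind]
  refine PMF.bind_congr_support fun A hA => ?_
  rw [PMF.bind_bind]
  refine PMF.bind_congr_support fun B hB => ?_
  rw [mem_support_sampleList_const] at hA hB
  have hpk : Val.ofList ((mixKeys key.1 A B).map fun a => Val.pair a.1.1 a.2.1) =
      (simCtx n key.1 (Val.ofList (A.map Prod.fst)) B).2.2.1 := by
    rw [simCtx, Val.toList_ofList, mixKeys_map, List.map_map]
    rfl
  have henc : derivedKey (Val.ofList ((mixKeys key.1 A B).map fun a => Val.pair a.1.1 a.2.1))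
      key.1 = Val.ofList (A.map Prod.fst) := by
    rw [hpk, derivedKey_simCtx, selectKeys_mixKeys hA.1 hB.1]
  rw [PMF.pure_bind, henc, hpk]
  rfl

/-! ### The adversary against the repetition -/

section Adversaries

variable (S E SS k) (V : ℕ × Val × Val × ℕ × Val → Bool)

/-- Completes the keys and runs the first stage with the simulated oracle. -/
noncomputable def simStage₁ (x : ℕ × Val × List Bool) : PMF (SimCtx × List Val × Val) :=
  (sampleList (x.2.2.map fun _ => S.gen x.1)).bind fun B =>
  (A₁.runLog (simDec S E SS V (simCtx x.1 x.2.2 x.2.1 B)) ([], Val.pair (Val.unary x.1)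
    (simCtx x.1 x.2.2 x.2.1 B).2.2.1)).bind fun r => PMF.pure (simCtx x.1 x.2.2 x.2.1 B, r)

/-- Runs the second stage with the simulated oracle, on the ciphertext, the signature and the
state. -/
noncomputable def simStage₂ (x : Val × Val × Val × SimCtx) : PMF (List Val × Val) :=
  A₂.runLog (simDec S E SS V x.2.2.2) ([], Val.pair (challenge x.2.2.2 x.1 x.2.1) x.2.2.1)

/-- The first stage of the adversary against the repetition. -/
noncomputable def cpaStage₁ (x : ℕ × Val) : PMF (Val × Val × Val × SimCtx × Val) :=
  (SS.gen x.1).bind fun key => (simStage₁ S E SS A₁ V (x.1, x.2, key.1)).bind fun t =>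
    PMF.pure (t.2.2.fst, t.2.2.snd.fst, t.2.2.snd.snd, t.1, key.2)

/-- The second stage of the adversary against the repetition. -/
noncomputable def cpaStage₂ (x : Val × Val × SimCtx × Val) : PMF Val :=
  (SS.sign x.2.2.1.1 x.2.2.2 x.1).bind fun sig =>
    (simStage₂ S E SS A₂ V (x.1, sig, x.2.1, x.2.2.1)).bind fun r => PMF.pure r.2

-- The received public keys play the role of `A`; the adversary draws the signature keys and `B`
-- itself. The challenge of the repetition is the first part of the challenge of the scheme, and
-- only the signature has to be added, with a signing key kept in the state. Messages and guess are
-- passed on unchanged.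
open Classical in
theorem cpaExperiment_eq (hvk : ∀ n, ∀ key ∈ (SS.gen n).support, key.1.length = k n)
    {B₁ B₂ : Prog} (h₁ : ∀ x, B₁.out (code x) = (cpaStage₁ S E SS A₁ V x).map code)
    (h₂ : ∀ x, B₂.out (code x) = (cpaStage₂ S E SS A₂ V x).map code) (n : ℕ) :
    (S.repetition E k).cpaExperiment B₁ B₂ n = (simGame S E SS k A₁ A₂ V n).map Prod.fst := by
  simp only [simGame, keyedGame, PMF.map_bind, challengeGame_map_fst]
  have hexp : (S.repetition E k).cpaExperiment B₁ B₂ n =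
      ((S.repetition E k).gen n).bind fun key =>
      (B₁.out (code (n, key.1))).bind fun y =>
      if y.fst ∈ E.msg n ∧ y.snd.fst ∈ E.msg n ∧ y.fst.size = y.snd.fst.size then
        fairCoin.bind fun b =>
        ((S.repetition E k).enc n key.1 (if b then y.snd.fst else y.fst)).bind fun c =>
        (B₂.out (Val.pair c y.snd.snd)).bind
          fun g => PMF.pure (decide (g = Val.bit true) == b)
      else fairCoin := rfl
  have hgen : (S.repetition E k).gen n =
      (sampleList (List.replicate (k n) (S.gen n))).map fun keys =>
        (Val.ofList (keys.map Prod.fst), Val.ofList (keys.map Prod.snd)) := rfl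
  have h₂' : ∀ c st (a : SimCtx) dsk, B₂.out (Val.pair c (Val.pair st (Val.pair (code a) dsk))) =
      cpaStage₂ S E SS A₂ V (c, st, a, dsk) := fun c st a dsk =>
    (h₂ (c, st, a, dsk)).trans (PMF.map_id _)
  have hcode : ∀ t : Val × Val × Val × SimCtx × Val, code t = Val.pair t.1 (Val.pair t.2.1
      (Val.pair t.2.2.1 (Val.pair (code t.2.2.2.1) t.2.2.2.2))) := fun _ => rfl
  rw [hexp]
  simp only [hgen, h₁, PMF.bind_map, Function.comp_def, PMF.bind_bind, PMF.pure_bind, cpaStage₁,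
    simStage₁, hcode, Val.fst_pair, Val.snd_pair, h₂', cpaStage₂, simStage₂]
  rw [PMF.bind_comm]
  refine PMF.bind_congr_support fun key hkey => ?_
  rw [sampleList_replicate_eq (hvk n key hkey)]
  congr 1
  funext A
  congr 1
  funext B
  rw [plainGame, ← Prog.runLog_map_snd _ _ ([], _), PMF.bind_map]
  congr 1
  funext r
  simp only [Function.comp]
  congr 1
  congr 1
  funext b
  congr 1
  funext c
  congr 1
  funext sig
  rw [← Prog.runLog_map_snd _ _ ([], _), PMF.bind_map]
  rfl

/-! ### The forger -/

/-- The first stage of the forger. -/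
noncomputable def forgerStage₁ (x : ℕ × List Bool) : PMF (Val × Option Val × Val × SimCtx) :=
  (sampleList (x.2.map fun _ => S.gen x.1)).bind fun A =>
  (simStage₁ S E SS A₁ V (x.1, Val.ofList (A.map Prod.fst), x.2)).bind fun t =>
  fairCoin.bind fun b =>
  ((S.repetition E k).enc x.1 (Val.ofList (A.map Prod.fst))
    (bif b then t.2.2.snd.fst else t.2.2.fst)).bind fun c =>
  -- After a forgery on `q.fst` in the first stage the challenge is no longer needed; the one
  -- signing request is spent on a different message.
  PMF.pure ((findLast (forgery SS t.1 Val.nil) t.2.1).elim c fun q => Val.pair q.fst Val.nil,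
    findLast (forgery SS t.1 Val.nil) t.2.1, t.2.2.snd.snd, t.1)

/-- The second stage of the forger. -/
noncomputable def forgerStage₂ (x : Val × Val × Option Val × Val × SimCtx) : PMF (Val × Val) :=
  x.2.2.1.elim
    ((simStage₂ S E SS A₂ V (x.1, x.2.1, x.2.2.2.1, x.2.2.2.2)).bind fun r =>
      PMF.pure ((findLast (forgery SS x.2.2.2.2 (challenge x.2.2.2.2 x.1 x.2.1)) r.1).elim
        (Val.nil, Val.nil) fun q => (q.fst, q.snd.snd)))
    fun q => PMF.pure (q.fst, q.snd.snd)

theorem forgery_eq_true {a : SimCtx} {ch q : Val} (h : forgery SS a ch q = true) :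
    q ≠ ch ∧ q = Val.pair q.fst (Val.pair (Val.ofBits a.2.1) q.snd.snd) ∧
      SS.ver a.1 a.2.1 q.fst q.snd.snd = true := by
  simpa [forgery, and_assoc] using h

theorem any_eq_of_findLast {β : Type} (P : β → Bool) (l : List β) :
    l.any P = (findLast P l).isSome := by
  rcases findLast_spec P l with ⟨b, hb, h1, h2⟩ | ⟨h1, h2⟩
  · rw [h1, Option.isSome_some, List.any_eq_true]
    exact ⟨b, hb, h2⟩
  · rw [h1, Option.isSome_none, List.any_eq_false]
    simpa using h2

/-- Signing is needed only once, for the challenge, and the simulated oracle needs no signing key.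
So the forger can play the whole simulated game, choosing the challenge bit itself, and hand in a
forgery found among the queries. -/
theorem simGame_le_otsuExperiment {F₁ F₂ : Prog}
    (h₁ : ∀ x, F₁.out (code x) = (forgerStage₁ S E SS k A₁ V x).map code)
    (h₂ : ∀ x, F₂.out (code x) = (forgerStage₂ S E SS A₂ V x).map code) (n : ℕ) :
    (simGame S E SS k A₁ A₂ V n).map Prod.snd true ≤ SS.otsuExperiment F₁ F₂ n true := by
  have hexp : SS.otsuExperiment F₁ F₂ n =
      (SS.gen n).bind fun key => (F₁.out (code (n, key.1))).bind fun r =>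
      (SS.sign n key.2 r.fst).bind fun sig =>
      (F₂.out (Val.pair r.fst (Val.pair sig r.snd))).bind fun f =>
      PMF.pure (SS.ver n key.1 f.fst f.snd && decide ((f.fst, f.snd) ≠ (r.fst, sig))) := rfl
  have hcode : ∀ t : Val × Option Val × Val × SimCtx, code t = Val.pair t.1 (code t.2) :=
    fun _ => rfl
  have hcode' : ∀ t : Val × Val, code t = Val.pair t.1 t.2 := fun _ => rfl
  have h₂' : ∀ m sig (t : Option Val × Val × SimCtx), F₂.out (Val.pair m (Val.pair sig (code t))) =
      (forgerStage₂ S E SS A₂ V (m, sig, t)).map code := fun m sig t => h₂ (m, sig, t)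
  simp only [simGame, keyedGame, PMF.map_bind]
  rw [hexp]
  simp only [h₁, PMF.bind_map, Function.comp_def, PMF.bind_bind, PMF.pure_bind, forgerStage₁,
    simStage₁, hcode, Val.fst_pair, Val.snd_pair, h₂', hcode']
  refine PMF.bind_apply_mono fun key _ => PMF.bind_apply_mono fun A _ =>
    PMF.bind_apply_mono fun B _ => ?_
  rw [challengeGame, PMF.map_bind]
  refine PMF.bind_apply_mono fun r _ => ?_
  generalize ha : simCtx n key.1 (Val.ofList (A.map Prod.fst)) B = a
  obtain ⟨rfl, hvk⟩ : a.1 = n ∧ a.2.1 = key.1 := by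
    subst ha
    exact ⟨rfl, rfl⟩
  rcases findLast_spec (forgery SS a Val.nil) r.1 with ⟨q, -, hq, hq'⟩ | ⟨hq, -⟩
  · obtain ⟨-, -, hver⟩ := forgery_eq_true SS hq'
    -- The message submitted for signing is longer than `q.fst`, so the forgery is on a new message
    -- and wins with probability 1.
    have hne : q.fst ≠ Val.pair q.fst Val.nil := fun h => by
      have := congrArg Val.size h
      simp [Val.size] at this
      omega
    refine (PMF.coe_le_one _ _).trans (le_of_eq ?_)
    simp [hq, forgerStage₂, ← hvk, hver, hne]
  · simp only [any_eq_of_findLast, hq, Option.isSome_none, Bool.false_or, Option.elim_none,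
      forgerStage₂, simStage₂, PMF.bind_bind, PMF.pure_bind]
    split_ifs with hvalid
    · simp only [PMF.map_bind, PMF.pure_map]
      refine PMF.bind_apply_mono fun b _ => ?_
      rw [← cond_eq_ite]
      refine PMF.bind_apply_mono fun c _ => PMF.bind_apply_mono fun sig _ =>
        PMF.bind_apply_mono fun g _ => ?_
      rcases findLast_spec (forgery SS a (challenge a c sig)) g.1 with
        ⟨q, -, hq, hq'⟩ | ⟨hq, -⟩
      · obtain ⟨hne, hform, hver⟩ := forgery_eq_true SS hq'
        -- Strong unforgeability matters here: the query may repeat the signed `c` with another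
        -- signature. It cannot repeat both, since it would then be the challenge itself.
        have hne' : ¬ (q.fst = c ∧ q.snd.snd = sig) := by
          rintro ⟨rfl, rfl⟩
          exact hne hform
        simp [hq, ← hvk, hver, hne']
      · simp [hq]
    -- For inadmissible messages the game ends without a forgery. The forger goes on without testing
    -- them, which does no harm to an inequality.
    · simp [PMF.map_bind, PMF.pure_map]

end Adversaries

end Games

/-! ### Efficiency of the two reductions. -/

section StageEfficiency

variable {S : PKE} {E : RandomizedEncoding} {SS : SignatureScheme}
  {V : ℕ × Val × Val × ℕ × Val → Bool} {A₁ A₂ : Prog}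

@[fun_prop]
theorem dpt_unary : DPT Val.unary :=
  DPT.of_prog Prog.id Prog.polyTime_id fun _ => Prog.outO_id _ _

theorem dpt_simCtx :
    DPT fun x : ℕ × List Bool × Val × List (Val × Val) => simCtx x.1 x.2.1 x.2.2.1 x.2.2.2 := by
  unfold simCtx mixKeys
  fun_prop

@[fun_prop]
theorem dpt_challenge : DPT fun x : SimCtx × Val × Val => challenge x.1 x.2.1 x.2.2 := by
  unfold challenge
  fun_prop

/-- `PPT.bind_prod` keeps the earlier data next to each new sample, so the nested product types in
this and the following proofs record what has been drawn so far. -/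
theorem ppt_simStage₁ (hS : S.Efficient) (hE : E.Efficient) (hSS : SS.Efficient) (hV : DPT V)
    (hA : A₁.PolyTime) : PPT (simStage₁ S E SS A₁ V) := by
  have h1 : PPT fun x : ℕ × Val × List Bool => sampleList (x.2.2.map fun _ => S.gen x.1) :=
    PPT.sampleList_map (f := fun x : (ℕ × Val × List Bool) × Bool => S.gen x.1.1)
      (hS.ppt_gen.comp (by fun_prop)) (by fun_prop)
  have h2 : PPT fun a : SimCtx => A₁.runLog (simDec S E SS V a)
      ([], Val.pair (Val.unary a.1) a.2.2.1) :=
    (PPT.runLog hA (dpt_simDec hS hE hSS hV)).comp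
      (f := fun a : SimCtx => (a, Val.pair (Val.unary a.1) a.2.2.1)) (by fun_prop)
  have h3 : DPT fun x : (ℕ × Val × List Bool) × List (Val × Val) =>
      simCtx x.1.1 x.1.2.2 x.1.2.1 x.2 :=
    dpt_simCtx.comp (f := fun x : (ℕ × Val × List Bool) × List (Val × Val) =>
      (x.1.1, x.1.2.2, x.1.2.1, x.2)) (by fun_prop)
  have h4 := PPT.comp (PPT.bind_prod h2 (g := fun y => PMF.pure y) dpt_id) h3
  exact h1.bind_prod h4

theorem ppt_simStage₂ (hS : S.Efficient) (hE : E.Efficient) (hSS : SS.Efficient) (hV : DPT V)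
    (hA : A₂.PolyTime) : PPT (simStage₂ S E SS A₂ V) :=
  (PPT.runLog hA (dpt_simDec hS hE hSS hV)).comp
    (f := fun x : Val × Val × Val × SimCtx =>
      (x.2.2.2, Val.pair (challenge x.2.2.2 x.1 x.2.1) x.2.2.1))
    (by
      have h : DPT fun x : Val × Val × Val × SimCtx => challenge x.2.2.2 x.1 x.2.1 :=
        dpt_challenge.comp (f := fun x : Val × Val × Val × SimCtx => (x.2.2.2, x.1, x.2.1))
          (by fun_prop)
      fun_prop)

theorem ppt_cpaStage₁ (hS : S.Efficient) (hE : E.Efficient) (hSS : SS.Efficient) (hV : DPT V)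
    (hA : A₁.PolyTime) : PPT (cpaStage₁ S E SS A₁ V) := by
  have h1 : PPT fun x : ℕ × Val => SS.gen x.1 := hSS.ppt_gen.comp (by fun_prop)
  have h2 : PPT fun x : (ℕ × Val) × List Bool × Val =>
      simStage₁ S E SS A₁ V (x.1.1, x.1.2, x.2.1) :=
    (ppt_simStage₁ hS hE hSS hV hA).comp (by fun_prop)
  have h3 : DPT fun y : ((ℕ × Val) × List Bool × Val) × SimCtx × List Val × Val =>
      (y.2.2.2.fst, y.2.2.2.snd.fst, y.2.2.2.snd.snd, y.2.1, y.1.2.2) := by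
    fun_prop
  exact h1.bind_prod (h2.bind_prod h3)

theorem ppt_cpaStage₂ (hS : S.Efficient) (hE : E.Efficient) (hSS : SS.Efficient) (hV : DPT V)
    (hA : A₂.PolyTime) : PPT (cpaStage₂ S E SS A₂ V) := by
  have h1 : PPT fun x : Val × Val × SimCtx × Val => SS.sign x.2.2.1.1 x.2.2.2 x.1 :=
    hSS.ppt_sign.comp (f := fun x : Val × Val × SimCtx × Val => (x.2.2.1.1, x.2.2.2, x.1))
      (by fun_prop)
  have h2 : PPT fun x : (Val × Val × SimCtx × Val) × Val =>
      simStage₂ S E SS A₂ V (x.1.1, x.2, x.1.2.1, x.1.2.2.1) :=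
    (ppt_simStage₂ hS hE hSS hV hA).comp (by fun_prop)
  exact h1.bind_prod (h2.bind (dpt_snd (α := List Val) (β := Val)))

theorem ppt_forgerStage₁ (k : ℕ → ℕ) (hS : S.Efficient) (hE : E.Efficient) (hSS : SS.Efficient)
    (hV : DPT V) (hA : A₁.PolyTime) : PPT (forgerStage₁ S E SS k A₁ V) := by
  have h1 : PPT fun x : ℕ × List Bool => sampleList (x.2.map fun _ => S.gen x.1) :=
    PPT.sampleList_map (f := fun x : (ℕ × List Bool) × Bool => S.gen x.1.1)
      (hS.ppt_gen.comp (by fun_prop)) (by fun_prop)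
  have h2 : PPT fun x : (ℕ × List Bool) × List (Val × Val) =>
      simStage₁ S E SS A₁ V (x.1.1, Val.ofList (x.2.map Prod.fst), x.1.2) :=
    (ppt_simStage₁ hS hE hSS hV hA).comp (by fun_prop)
  have h3 : PPT fun x : (((ℕ × List Bool) × List (Val × Val)) × SimCtx × List Val × Val) × Bool =>
      (S.repetition E k).enc x.1.1.1.1 (Val.ofList (x.1.1.2.map Prod.fst))
        (bif x.2 then x.1.2.2.2.snd.fst else x.1.2.2.2.fst) :=
    (ppt_repetition_enc k hS hE).comp
      (f := fun x : (((ℕ × List Bool) × List (Val × Val)) × SimCtx × List Val × Val) × Bool =>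
        (x.1.1.1.1, Val.ofList (x.1.1.2.map Prod.fst),
          bif x.2 then x.1.2.2.2.snd.fst else x.1.2.2.2.fst)) (by fun_prop)
  have h4 : DPT fun a : SimCtx × List Val => findLast (forgery SS a.1 Val.nil) a.2 :=
    DPT.findLast ((dpt_forgery hSS).comp
      (f := fun a : (SimCtx × List Val) × Val => ((a.1.1, Val.nil), a.2)) (by fun_prop)) dpt_snd
  have h5 : DPT fun x : ((((ℕ × List Bool) × List (Val × Val)) × SimCtx × List Val × Val) × Bool) ×
      Val => findLast (forgery SS x.1.1.2.1 Val.nil) x.1.1.2.2.1 :=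
    h4.comp (f := fun x : ((((ℕ × List Bool) × List (Val × Val)) × SimCtx × List Val × Val) ×
      Bool) × Val => (x.1.1.2.1, x.1.1.2.2.1)) (by fun_prop)
  have h6 : DPT fun x : ((((ℕ × List Bool) × List (Val × Val)) × SimCtx × List Val × Val) × Bool) ×
      Val => ((findLast (forgery SS x.1.1.2.1 Val.nil) x.1.1.2.2.1).elim x.2
        fun q => Val.pair q.fst Val.nil, findLast (forgery SS x.1.1.2.1 Val.nil) x.1.1.2.2.1,
        x.1.1.2.2.2.snd.snd, x.1.1.2.1) := by
    fun_prop
  exact h1.bind_prod (h2.bind_prod (ppt_fairCoin.bind_prod (h3.bind_prod h6)))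

theorem ppt_forgerStage₂ (hS : S.Efficient) (hE : E.Efficient) (hSS : SS.Efficient) (hV : DPT V)
    (hA : A₂.PolyTime) : PPT (forgerStage₂ S E SS A₂ V) := by
  have h1 : PPT fun x : Val × Val × Option Val × Val × SimCtx =>
      simStage₂ S E SS A₂ V (x.1, x.2.1, x.2.2.2.1, x.2.2.2.2) :=
    (ppt_simStage₂ hS hE hSS hV hA).comp (by fun_prop)
  have h2 : DPT fun y : (Val × Val × Option Val × Val × SimCtx) × List Val × Val =>
      challenge y.1.2.2.2.2 y.1.1 y.1.2.1 :=
    dpt_challenge.comp (f := fun y : (Val × Val × Option Val × Val × SimCtx) × List Val × Val =>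
      (y.1.2.2.2.2, y.1.1, y.1.2.1)) (by fun_prop)
  have h3 : DPT fun y : (Val × Val × Option Val × Val × SimCtx) × List Val × Val =>
      findLast (forgery SS y.1.2.2.2.2 (challenge y.1.2.2.2.2 y.1.1 y.1.2.1)) y.2.1 := by
    refine DPT.findLast ((dpt_forgery hSS).comp
      (f := fun a : ((Val × Val × Option Val × Val × SimCtx) × List Val × Val) × Val =>
        ((a.1.1.2.2.2.2, challenge a.1.1.2.2.2.2 a.1.1.1 a.1.1.2.1), a.2)) ?_) (by fun_prop)
    fun_prop
  have h4 : DPT fun y : (Val × Val × Option Val × Val × SimCtx) × List Val × Val =>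
      (findLast (forgery SS y.1.2.2.2.2 (challenge y.1.2.2.2.2 y.1.1 y.1.2.1)) y.2.1).elim
        (Val.nil, Val.nil) fun q => (q.fst, q.snd.snd) := by
    fun_prop
  have h5 : DPT fun y : (Val × Val × Option Val × Val × SimCtx) × Val =>
      (y.2.fst, y.2.snd.snd) := by
    fun_prop
  exact PPT.option_elim (o := fun x : Val × Val × Option Val × Val × SimCtx => x.2.2.1)
    (by fun_prop) (h1.bind_prod h4) h5

end StageEfficiency

/-! ### The security theorem. -/

theorem theorem1 (S : PKE) (E : RandomizedEncoding) (SS : SignatureScheme) (k : ℕ → ℕ)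
    (hS : S.Efficient) (hE : E.Efficient) (hSS : SS.Efficient)
    (hvk : ∀ n, ∀ key ∈ (SS.gen n).support, key.1.length = k n)
    (hunf : SS.OneTimeStronglyUnforgeable)
    (hcpa : (S.repetition E k).INDCPA)
    (hver : S.VerifiableRepetition E k) :
    (S.cca2 E SS k).INDCCA2 := by
  obtain ⟨V, hVpoly, hV⟩ := hver
  have hVdpt : DPT V := by
    obtain ⟨p, hp, hp'⟩ := hVpoly
    exact DPT.of_prog p hp hp'
  intro A₁ A₂ hA₁ hA₂
  obtain ⟨B₁, hB₁, hB₁'⟩ := ppt_cpaStage₁ hS hE hSS hVdpt hA₁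
  obtain ⟨B₂, hB₂, hB₂'⟩ := ppt_cpaStage₂ hS hE hSS hVdpt hA₂
  obtain ⟨F₁, hF₁, hF₁'⟩ := ppt_forgerStage₁ k hS hE hSS hVdpt hA₁
  obtain ⟨F₂, hF₂, hF₂'⟩ := ppt_forgerStage₂ hS hE hSS hVdpt hA₂
  -- By the triangle inequality through the IND-CPA experiment, the IND-CCA2 advantage is at most
  -- the IND-CPA advantage of `B₁`, `B₂` plus the forging probability of `F₁`, `F₂`.
  refine Asymptotics.SuperpolynomialDecay.trans_abs_le
    ((hcpa B₁ B₂ hB₁ hB₂).add (hunf F₁ F₂ hF₁ hF₂)) fun n => ?_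
  have h1 := PMF.abs_sub_le_of_bad (realGame_apply_eq A₁ A₂ hvk hV n)
  rw [← cca2Experiment_eq A₁ A₂ hvk, ← cpaExperiment_eq S E SS k A₁ A₂ V hvk hB₁' hB₂'] at h1
  have h2 := ENNReal.toReal_mono (PMF.apply_ne_top _ _)
    (simGame_le_otsuExperiment S E SS k A₁ A₂ V hF₁' hF₂' n)
  rw [abs_abs]
  refine le_trans ?_ (le_abs_self _)
  refine (abs_sub_le _ ((S.repetition E k).cpaExperiment B₁ B₂ n true).toReal _).trans ?_
  simp only [Pi.add_apply]
  linarith
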